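/- **Setting.** Let $M$ be a smooth, Hausdorff, second countable $n$-manifold, $N=TM\setminus\{0\}$, and let $L:N\to\mathbb R$ be a pseudo-Finsler structure: $L$ is smooth, $L(x,ky)=k^2L(x,y)$ for $k>0$, and the vertical Hessian $g_{\mu\nu}=\partial^2L/\partial y^\mu\partial y^\nu$ is nondegenerate with the same signature at all points of $N$. A geodesic of $L$ is a smooth curve with nowhere vanishing velocity which is a critical point of $\int L(\gamma,\dot\gamma)\,ds$ under smooth variations fixed outside a compact interval. Let $\mathcal S=y^\mu\frac{\partial}{\partial x^\mu}-S^\mu(x,y)\frac{\partial}{\partial y^\mu}$ be a Finsler spray of $L$: a smooth spray on $N$ ($S^\mu$ positively homogeneous of degree $2$ in $y$) whose integral curves are exactly the velocity lifts of the geodesics of $L$. In a chart put $$N^\mu{}_\nu=\tfrac12\frac{\partial S^\mu}{\partial y^\nu},\qquad \Gamma^\mu_{\nu\rho}=\frac{\partial N^\mu{}_\nu}{\partial y^\rho}=\tfrac12\frac{\partial^2S^\mu}{\partial y^\nu\partial y^\rho},\qquad \frac{\delta}{\delta x^\nu}=\frac{\partial}{\partial x^\nu}-N^\mu{}_\nu\frac{\partial}{\partial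 y^\mu}.$$ Let $\nabla$ be the connection on the pull-back $\pi^*TM$ with coefficients $\Gamma^\mu_{\nu\rho}$ in the horizontal directions $\delta/\delta x^\nu$ and zero coefficients in the vertical directions $\partial/\partial y^\nu$. Its curvatures are, for $a,b,c,v\in T_xM$, $$\big(R(a,b)c\big)^\mu=\Big(\frac{\delta\Gamma^\mu_{\nu\rho}}{\delta x^\sigma}-\frac{\delta\Gamma^\mu_{\sigma\rho}}{\delta x^\nu}+\Gamma^\mu_{\sigma\lambda}\Gamma^\lambda_{\nu\rho}-\Gamma^\mu_{\nu\lambda}\Gamma^\lambda_{\sigma\rho}\Big)a^\sigma b^\nu c^\rho,\qquad \big(P(v^v,a)b\big)^\mu=\frac{\partial\Gamma^\mu_{\nu\rho}}{\partial y^\sigma}\,a^\nu b^\rho v^\sigma ,$$ where $v^v$ is the vertical lift of $v$. For a tensor $T$ along $\pi$, $\nabla_wT$ is its covariant derivative in the direction of the horizontal lift of $w$ and $\nabla_{w^v}T$ that in the direction of the vertical lift. Let $I\subset\mathbb R$ be an open interval, $\epsilon_0>0$, and let $\Lambda:(-\epsilon_0,\epsilon_0)\times I\to M$ be smooth with $X=\Lambda(0,\cdot)$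 a geodesic of $\mathcal S$. Fix a chart and consider those $s\in I$ for which $X(s)$ is in its domain. Write $\Xi^\mu(\epsilon,s)=\Lambda^\mu(\epsilon,s)-\Lambda^\mu(0,s)$ and $\Xi_k^\mu(s)=\partial_\epsilon^k\Xi^\mu(0,s)$, so that $\Xi^\mu=\epsilon\,\Xi_1^\mu+\tfrac{\epsilon^2}{2}\Xi_2^\mu+O(\epsilon^3)$. Let $G_k^\mu(s)$ be the coefficient of $\epsilon^k$ in the Taylor expansion at $\epsilon=0$ of the left-hand side of the exact deviation equation, $$\ddot\Xi^\mu+\Gamma^\mu_{\nu\sigma}(X+\Xi,\dot X+\dot\Xi)(\dot X^\nu+\dot\Xi^\nu)(\dot X^\sigma+\dot\Xi^\sigma)-\Gamma^\mu_{\nu\sigma}(X,\dot X)\dot X^\nu\dot X^\sigma .$$ The $k$-th order geodesic deviation equation is $G_k=0$. For vector fields $V$ along $X$ let $(\nabla_{\dot X}V)^\mu=\dot V^\mu+\Gamma^\mu_{\nu\rho}(X,\dot X)\dot X^\nu V^\rho$, evaluate all tensors at $(X,\dot X)$, and put $J_2^\mu=\Xi_2^\mu+\Gamma^\mu_{\nu\rho}(X,\dot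 X)\Xi_1^\nu\Xi_1^\rho$. **Proposition.** 1. The first order geodesic deviation equation is the Jacobi equation: $G_1=\nabla_{\dot X}\nabla_{\dot X}\Xi_1+R(\Xi_1,\dot X)\dot X$, so $G_1=0$ reads $$\nabla_{\dot X}\nabla_{\dot X}\Xi_1+R(\Xi_1,\dot X)\dot X=0 .$$ 2. At every $s$ at which $G_1=0$, the second order geodesic deviation equation $G_2=0$ is the nonlinear equation $$\begin{aligned}\nabla_{\dot X}\nabla_{\dot X}J_2+R(J_2,\dot X)\dot X={}&(\nabla_{\Xi_1}R)(\dot X,\Xi_1)\dot X+(\nabla_{\dot X}R)(\dot X,\Xi_1)\Xi_1+4R(\dot X,\Xi_1)(\nabla_{\dot X}\Xi_1)\\&-\big(\nabla_{(\nabla_{\dot X}\Xi_1)^v}P\big)\big((\nabla_{\dot X}\Xi_1)^v,\dot X\big)\dot X-2(\nabla_{\Xi_1}P)\big((\nabla_{\dot X}\Xi_1)^v,\dot X\big)\dot X;\end{aligned}$$ more precisely, $2G_2$ is the left-hand side minus the right-hand side of this equation. 3. In particular, if all the curves $\Lambda(\epsilon,\cdot)$ are geodesics of $\mathcal S$, then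 $\Xi_1$ and $J_2$ satisfy both equations. 4. The equations are covariant: under a change of chart $\chi$ the components of $\Xi_1$, of $J_2$, of the left-hand side of the first equation and, where $G_1=0$, of the difference of the two sides of the second equation are transformed by the differential $D\chi_{X(s)}$. -/

import Mathlib

open Set Topology
open scoped Manifold ContDiff

noncomputable section

namespace FinslerDeviation

/-- The model space `ℝⁿ`. -/
abbrev Coord (n : ℕ) : Type := EuclideanSpace ℝ (Fin n)

/-! ### Pseudo-Finsler structures, sprays and geodesics on a manifold -/

section Manifold

variable {n : ℕ} {M : Type*} [TopologicalSpace M] [ChartedSpace (Coord n) M]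

/-- The slit tangent bundle `N = TM ∖ {0}`. -/
def slit (n : ℕ) (M : Type*) [TopologicalSpace M] [ChartedSpace (Coord n) M] :
    Set (TangentBundle 𝓘(ℝ, Coord n) M) :=
  {u | u.2 ≠ 0}

/-- The velocity `(γ(t), γ'(t)) ∈ TM` of a curve in `M`. -/
def velocity (γ : ℝ → M) (t : ℝ) : TangentBundle 𝓘(ℝ, Coord n) M :=
  tangentMap 𝓘(ℝ, ℝ) 𝓘(ℝ, Coord n) γ ⟨t, (1 : ℝ)⟩

/-- The vertical Hessian `g_u(v, w)`, `v, w ∈ T_x M`, of a function `L` on `TM` at `u = (x, y)`: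
the second derivative of `L(x, ·)` at `y` in the directions `v` and `w`. -/
def vertHessian (L : TangentBundle 𝓘(ℝ, Coord n) M → ℝ) (u : TangentBundle 𝓘(ℝ, Coord n) M)
    (v w : TangentSpace 𝓘(ℝ, Coord n) u.1) : ℝ :=
  lineDeriv ℝ (fun y : TangentSpace 𝓘(ℝ, Coord n) u.1 =>
    lineDeriv ℝ (fun z : TangentSpace 𝓘(ℝ, Coord n) u.1 => L ⟨u.1, z⟩) y v) u.2 w

/-- `L` is a pseudo-Finsler structure: smooth on `N`, positively homogeneous of degree two on the
fibres, with vertical Hessian nondegenerate and of one and the same signature at all points of `N`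
(`q` minus signs and `n - q` plus signs). -/
structure IsPseudoFinsler [IsManifold 𝓘(ℝ, Coord n) ∞ M]
    (L : TangentBundle 𝓘(ℝ, Coord n) M → ℝ) : Prop where
  smooth : ContMDiffOn 𝓘(ℝ, Coord n).tangent 𝓘(ℝ, ℝ) ∞ L (slit n M)
  homogeneous : ∀ u ∈ slit n M, ∀ k : ℝ, 0 < k → L ⟨u.1, k • u.2⟩ = k ^ 2 * L u
  signature : ∃ q : ℕ, q ≤ n ∧ ∀ u ∈ slit n M,
    ∃ b : Module.Basis (Fin n) ℝ (TangentSpace 𝓘(ℝ, Coord n) u.1), ∀ i j : Fin n,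
      vertHessian L u (b i) (b j) = if i = j then (if (i : ℕ) < q then -1 else 1) else 0

/-- `γ` is a geodesic of `L` on the open interval `I`: a smooth curve with nowhere zero velocity
that is a critical point of the functional `∫ L(γ, γ') ds` with respect to all smooth variations
that fix the curve outside a compact subinterval `[a, b]` of `I`. -/
structure IsGeodesicOf (L : TangentBundle 𝓘(ℝ, Coord n) M → ℝ) (γ : ℝ → M) (I : Set ℝ) :
    Prop where
  smooth : ContMDiffOn 𝓘(ℝ, ℝ) 𝓘(ℝ, Coord n) ∞ γ I
  velocity_mem : ∀ t ∈ I, velocity γ t ∈ slit n M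
  critical : ∀ (V : ℝ × ℝ → M) (δ a b : ℝ), 0 < δ → a < b → Icc a b ⊆ I →
    ContMDiffOn 𝓘(ℝ, ℝ × ℝ) 𝓘(ℝ, Coord n) ∞ V (Ioo (-δ) δ ×ˢ I) →
    (∀ t ∈ I, V (0, t) = γ t) →
    (∀ ε ∈ Ioo (-δ) δ, ∀ t ∈ I \ Ioo a b, V (ε, t) = γ t) →
    HasDerivAt (fun ε : ℝ => ∫ t in a..b, L (velocity (fun s => V (ε, s)) t)) 0 0

/-- A vector field on `TM` (only its values on `N` matter). -/
abbrev FieldOnTangent (n : ℕ) (M : Type*) [TopologicalSpace M] [ChartedSpace (Coord n) M]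
    [IsManifold 𝓘(ℝ, Coord n) ∞ M] : Type _ :=
  (u : TangentBundle 𝓘(ℝ, Coord n) M) → TangentSpace 𝓘(ℝ, Coord n).tangent u

/-- The point of `TM` with coordinates `(x, y)` in the chart of `TM` induced by `φ`. -/
def ofCoord (φ : OpenPartialHomeomorph M (Coord n)) (p : Coord n × Coord n) :
    TangentBundle 𝓘(ℝ, Coord n) M :=
  ⟨φ.symm p.1, mfderiv 𝓘(ℝ, Coord n) 𝓘(ℝ, Coord n) φ.symm p.1 p.2⟩

/-- The coordinates `(x, y)` of a point of `TM` in the chart of `TM` induced by `φ`. -/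
def toCoord (φ : OpenPartialHomeomorph M (Coord n)) (u : TangentBundle 𝓘(ℝ, Coord n) M) :
    Coord n × Coord n :=
  (φ u.1, mfderiv 𝓘(ℝ, Coord n) 𝓘(ℝ, Coord n) φ u.1 u.2)

variable [IsManifold 𝓘(ℝ, Coord n) ∞ M]

/-- The components `S^μ(x, y)` of a semispray `S = y^μ ∂/∂x^μ - S^μ ∂/∂y^μ` in the chart `φ`. -/
def sprayCoeff (S : FieldOnTangent n M) (φ : OpenPartialHomeomorph M (Coord n))
    (p : Coord n × Coord n) : Coord n :=
  -(show Coord n × Coord n from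
      mfderiv 𝓘(ℝ, Coord n).tangent 𝓘(ℝ, Coord n × Coord n) (toCoord φ) (ofCoord φ p)
        (S (ofCoord φ p))).2

/-- `S` is a spray on `N`: a smooth vector field with `π_* S(u) = u`, whose components in every
chart are positively homogeneous of degree two in `y`. -/
structure IsSpray (S : FieldOnTangent n M) : Prop where
  smooth : ContMDiffOn 𝓘(ℝ, Coord n).tangent 𝓘(ℝ, Coord n).tangent.tangent ∞
    (fun u => (⟨u, S u⟩ : TangentBundle 𝓘(ℝ, Coord n).tangent (TangentBundle 𝓘(ℝ, Coord n) M)))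
    (slit n M)
  semispray : ∀ u ∈ slit n M,
    mfderiv 𝓘(ℝ, Coord n).tangent 𝓘(ℝ, Coord n)
      (fun w : TangentBundle 𝓘(ℝ, Coord n) M => w.1) u (S u) = u.2
  homogeneous : ∀ φ ∈ IsManifold.maximalAtlas 𝓘(ℝ, Coord n) ∞ M, ∀ x ∈ φ.target,
    ∀ y : Coord n, y ≠ 0 → ∀ k : ℝ, 0 < k → sprayCoeff S φ (x, k • y) = k ^ 2 • sprayCoeff S φ (x, y)

/-- `S` is a Finsler spray of `L`: it is a spray whose integral curves are exactly the
velocity lifts of the geodesics of `L`. -/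
structure IsFinslerSpray (L : TangentBundle 𝓘(ℝ, Coord n) M → ℝ) (S : FieldOnTangent n M) :
    Prop where
  isSpray : IsSpray S
  integralCurves : ∀ I : Set ℝ, IsOpen I → I.OrdConnected →
    ∀ u : ℝ → TangentBundle 𝓘(ℝ, Coord n) M,
      ((∀ t ∈ I, u t ∈ slit n M) ∧ IsMIntegralCurveOn u S I) ↔
        ∃ γ : ℝ → M, IsGeodesicOf L γ I ∧ EqOn u (velocity γ) I

/-- `γ` is a geodesic of the spray `S` on `I`: its velocity lift is an integral curve of `S`
in `N`. -/
def IsSprayGeodesic (S : FieldOnTangent n M) (γ : ℝ → M) (I : Set ℝ) : Prop :=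
  (∀ t ∈ I, velocity γ t ∈ slit n M) ∧ IsMIntegralCurveOn (velocity γ) S I

end Manifold

/-! ### The connection of a spray and its curvatures, in a chart

Below `F : (x, y) ↦ S(x, y)` are the spray coefficients in a chart. All tensors are along
`π : N → M`; a tensor is evaluated at `p = (x, y)` and at vectors of `ℝⁿ`. -/

section Coordinates

variable {n : ℕ}

/-- The nonlinear connection `N^μ_ν(p) v^ν`, where `N^μ_ν = ½ ∂S^μ/∂y^ν`. -/
def nonlinConn (F : Coord n × Coord n → Coord n) (p : Coord n × Coord n) (v : Coord n) : Coord n :=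
  (1 / 2 : ℝ) • fderiv ℝ F p (0, v)

/-- The connection coefficients `Γ^μ_{νρ}(p) v^ν w^ρ`, where
`Γ^μ_{νρ} = ∂N^μ_ν/∂y^ρ = ½ ∂²S^μ/∂y^ν∂y^ρ`. -/
def christoffel (F : Coord n × Coord n → Coord n) (p : Coord n × Coord n) (v w : Coord n) :
    Coord n :=
  fderiv ℝ (fun q => nonlinConn F q v) p (0, w)

/-- The horizontal derivative `w^ν δf/δx^ν`, where `δ/δx^ν = ∂/∂x^ν - N^μ_ν ∂/∂y^μ`. -/
def horDeriv (F f : Coord n × Coord n → Coord n) (p : Coord n × Coord n) (w : Coord n) : Coord n :=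
  fderiv ℝ f p (w, -nonlinConn F p w)

/-- The Riemann type (`hh`-)curvature `R_p(a, b) c`. -/
def hhCurv (F : Coord n × Coord n → Coord n) (p : Coord n × Coord n) (a b c : Coord n) : Coord n :=
  horDeriv F (fun q => christoffel F q b c) p a - horDeriv F (fun q => christoffel F q a c) p b
    + christoffel F p a (christoffel F p b c) - christoffel F p b (christoffel F p a c)

/-- The `hv`-curvature `P_p(v^v, a) b = P^μ_{νρσ} a^ν b^ρ v^σ`, where
`P^μ_{νρσ} = ∂Γ^μ_{νρ}/∂y^σ`. -/
def hvCurv (F : Coord n × Coord n → Coord n) (p : Coord n × Coord n) (v a b : Coord n) : Coord n :=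
  fderiv ℝ (fun q => christoffel F q a b) p (0, v)

/-- The horizontal covariant derivative `(∇_w T)(a, b) c` at `p` of a tensor `T` along `π`
(the derivative in the direction of the horizontal lift of `w`). -/
def horCov (F : Coord n × Coord n → Coord n)
    (T : Coord n × Coord n → Coord n → Coord n → Coord n → Coord n)
    (p : Coord n × Coord n) (w a b c : Coord n) : Coord n :=
  horDeriv F (fun q => T q a b c) p w + christoffel F p w (T p a b c)
    - T p (christoffel F p w a) b c - T p a (christoffel F p w b) c
    - T p a b (christoffel F p w c)

/-- The vertical covariant derivative `(∇_{w^v} T)(a, b) c` at `p` of a tensor `T` along `π`; the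
connection has no coefficients in the vertical directions. -/
def vertCov (T : Coord n × Coord n → Coord n → Coord n → Coord n → Coord n)
    (p : Coord n × Coord n) (w a b c : Coord n) : Coord n :=
  fderiv ℝ (fun q => T q a b c) p (0, w)

/-! ### Ribbons and deviation equations, in a chart

Below `x ε s` are the chart coordinates of a ribbon; `x 0` is the central geodesic `X`. -/

/-- The velocity lift `(X(s), Ẋ(s))` of the central curve. -/
def central (x : ℝ → ℝ → Coord n) (s : ℝ) : Coord n × Coord n :=
  (x 0 s, deriv (x 0) s)

/-- The ribbon coordinate function `Ξ(ε, s) = Λ(ε, s) - Λ(0, s)`. -/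
def ribbonDiff (x : ℝ → ℝ → Coord n) (ε s : ℝ) : Coord n := x ε s - x 0 s

/-- The Taylor coefficients `Ξ_k(s) = ∂^k Ξ/∂ε^k (0, s)`, so that `Ξ = ∑ ε^k Ξ_k / k!`. -/
def xiCoeff (x : ℝ → ℝ → Coord n) (k : ℕ) (s : ℝ) : Coord n :=
  iteratedDeriv k (fun ε => ribbonDiff x ε s) 0

/-- The left-hand side of the exact deviation equation for the displacement `Ξ(ε, ·)`:
`ξ̈ + Γ(X + ξ, Ẋ + ξ̇)(Ẋ + ξ̇, Ẋ + ξ̇) - Γ(X, Ẋ)(Ẋ, Ẋ)`. -/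
def exactDeviation (F : Coord n × Coord n → Coord n) (x : ℝ → ℝ → Coord n) (ε s : ℝ) : Coord n :=
  deriv (deriv (ribbonDiff x ε)) s
    + christoffel F (x 0 s + ribbonDiff x ε s, deriv (x 0) s + deriv (ribbonDiff x ε) s)
        (deriv (x 0) s + deriv (ribbonDiff x ε) s) (deriv (x 0) s + deriv (ribbonDiff x ε) s)
    - christoffel F (central x s) (deriv (x 0) s) (deriv (x 0) s)

/-- `G_k(s)`, the coefficient of `ε^k` in the expansion of the exact deviation equation. The
geodesic deviation equation of order `k` is `G_k = 0`. -/
def devCoeff (F : Coord n × Coord n → Coord n) (x : ℝ → ℝ → Coord n) (k : ℕ) (s : ℝ) : Coord n :=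
  ((k.factorial : ℝ)⁻¹) • iteratedDeriv k (fun ε => exactDeviation F x ε s) 0

/-- The covariant derivative `∇_Ẋ V` of a vector field `V` along the central curve, with
connection coefficients taken at `(X, Ẋ)`. -/
def covAlong (F : Coord n × Coord n → Coord n) (x : ℝ → ℝ → Coord n) (V : ℝ → Coord n) (s : ℝ) :
    Coord n :=
  deriv V s + christoffel F (central x s) (deriv (x 0) s) (V s)

/-- The field `J₂ = Ξ₂ + Γ(X, Ẋ)(Ξ₁, Ξ₁)`. -/
def jTwo (F : Coord n × Coord n → Coord n) (x : ℝ → ℝ → Coord n) (s : ℝ) : Coord n :=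
  xiCoeff x 2 s + christoffel F (central x s) (xiCoeff x 1 s) (xiCoeff x 1 s)

/-- The Jacobi operator `∇_Ẋ ∇_Ẋ V + R(V, Ẋ) Ẋ`. -/
def jacobiOp (F : Coord n × Coord n → Coord n) (x : ℝ → ℝ → Coord n) (V : ℝ → Coord n) (s : ℝ) :
    Coord n :=
  covAlong F x (covAlong F x V) s
    + hhCurv F (central x s) (V s) (deriv (x 0) s) (deriv (x 0) s)

/-- The right-hand side of the second order deviation equation, with `D = ∇_Ẋ Ξ₁`:
`(∇_{Ξ₁} R)(Ẋ, Ξ₁)Ẋ + (∇_Ẋ R)(Ẋ, Ξ₁)Ξ₁ + 4 R(Ẋ, Ξ₁)D - (∇_{D^v} P)(D^v, Ẋ)Ẋ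
  - 2 (∇_{Ξ₁} P)(D^v, Ẋ)Ẋ`. -/
def secondOrderRHS (F : Coord n × Coord n → Coord n) (x : ℝ → ℝ → Coord n) (s : ℝ) : Coord n :=
  let p : Coord n × Coord n := central x s
  let T : Coord n := deriv (x 0) s
  let ξ : Coord n := xiCoeff x 1 s
  let D : Coord n := covAlong F x (xiCoeff x 1) s
  horCov F (hhCurv F) p ξ T ξ T + horCov F (hhCurv F) p T T ξ ξ + (4 : ℝ) • hhCurv F p T ξ D
    - vertCov (hvCurv F) p D D T T - (2 : ℝ) • horCov F (hvCurv F) p ξ D T T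

end Coordinates

/-- The chart coordinates of a ribbon `Λ : (ε, s) ↦ Λ(ε, s) ∈ M`. -/
def ribbonCoord {n : ℕ} {M : Type*} [TopologicalSpace M] [ChartedSpace (Coord n) M]
    (φ : OpenPartialHomeomorph M (Coord n)) (Λ : ℝ × ℝ → M) (ε s : ℝ) : Coord n :=
  φ (Λ (ε, s))

end FinslerDeviation

end

open FinslerDeviation

noncomputable section

set_option maxSynthPendingDepth 3

namespace FinslerDeviation

/-! ### Product rules and symmetry of iterated derivatives -/

section Calculus

variable {Z E F G H : Type*} [NormedAddCommGroup Z] [NormedSpace ℝ Z]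
  [NormedAddCommGroup E] [NormedSpace ℝ E] [NormedAddCommGroup F] [NormedSpace ℝ F]
  [NormedAddCommGroup G] [NormedSpace ℝ G] [NormedAddCommGroup H] [NormedSpace ℝ H]

/-! Write `x(ε, s)` for the ribbon in a chart, T = ∂_s x, ξ = ∂_ε x, and let D_s, D_ε be covariant
derivatives on the parameter surface, with coefficients taken along the lift `(x, T)`. Homogeneity
of degree two gives `Γ(y, y) = S`, and the central curve is a geodesic, so the left side of the
exact deviation equation is the acceleration A = D_s T (`exactDeviation_eq`). Hence G₁ = ∂_ε A and 2
G₂ = ∂_ε² A at ε = 0. Since A vanishes on the central curve, ∂_ε A = D_ε A there; if ∂_ε A vanishes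
too, ∂_ε² A = D_ε D_ε A.

It remains to move D_ε to the right. The commutator of D_ε and D_s is R plus vertical derivatives of
Γ (`covD_covD_comm`), and there is no torsion: D_ε T = D_s ξ. By Euler's identities a vertical
derivative of Γ vanishes when y is one of its arguments, so D_ε A = D_s D_s ξ + R(ξ, T)T
(`covD_accel`), which is the Jacobi operator.

A second D_ε produces D_s D_s J₂ + R(J₂, T)T, where J₂ = D_ε ξ, together with derivatives of R and
curvature terms in D = D_s ξ (`fderiv_fderiv_accel`). The vertical derivative of R applied to T
vanishes (`IsBerwald.fderiv_curv_self`), and the first Bianchi identity gathers the remaining terms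
into 4 R(T, ξ)D. The two P terms of the stated equation are zero, again by homogeneity.

Covariance follows from A being a vector: under a change of chart, higher derivatives of χ multiply
only A or ∂_ε A, which vanish where needed. For J₂, the inhomogeneous law of Γ cancels that of Ξ₂.
-/

theorem fderiv_clm_apply_one {g : Z → E →L[ℝ] F} {a : Z → E} {z : Z}
    (hg : DifferentiableAt ℝ g z) (ha : DifferentiableAt ℝ a z) (v : Z) :
    fderiv ℝ (fun z => g z (a z)) z v = fderiv ℝ g z v (a z) + g z (fderiv ℝ a z v) := by
  rw [fderiv_clm_apply hg ha]
  simp [add_comm]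

theorem fderiv_clm_apply_two {g : Z → E →L[ℝ] F →L[ℝ] G} {a : Z → E} {b : Z → F} {z : Z}
    (hg : DifferentiableAt ℝ g z) (ha : DifferentiableAt ℝ a z) (hb : DifferentiableAt ℝ b z)
    (v : Z) :
    fderiv ℝ (fun z => g z (a z) (b z)) z v
      = fderiv ℝ g z v (a z) (b z) + g z (fderiv ℝ a z v) (b z) + g z (a z) (fderiv ℝ b z v) := by
  rw [fderiv_clm_apply_one (hg.clm_apply ha) hb, fderiv_clm_apply_one hg ha]
  simp

theorem fderiv_clm_apply_three {g : Z → E →L[ℝ] F →L[ℝ] G →L[ℝ] H} {a : Z → E} {b : Z → F}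
    {d : Z → G} {z : Z} (hg : DifferentiableAt ℝ g z) (ha : DifferentiableAt ℝ a z)
    (hb : DifferentiableAt ℝ b z) (hd : DifferentiableAt ℝ d z) (v : Z) :
    fderiv ℝ (fun z => g z (a z) (b z) (d z)) z v
      = fderiv ℝ g z v (a z) (b z) (d z) + g z (fderiv ℝ a z v) (b z) (d z)
        + g z (a z) (fderiv ℝ b z v) (d z) + g z (a z) (b z) (fderiv ℝ d z v) := by
  rw [fderiv_clm_apply_one ((hg.clm_apply ha).clm_apply hb) hd, fderiv_clm_apply_two hg ha hb]
  simp

theorem fderiv_comp_apply {g : E → F} {c : Z → E} {z : Z} (hg : DifferentiableAt ℝ g (c z))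
    (hc : DifferentiableAt ℝ c z) (v : Z) :
    fderiv ℝ (fun z => g (c z)) z v = fderiv ℝ g (c z) (fderiv ℝ c z v) := by
  have := fderiv_comp z hg hc
  rw [Function.comp_def] at this
  rw [this]; rfl

theorem fderiv_fst_apply {c : Z → E × F} {z : Z} (hc : DifferentiableAt ℝ c z) (v : Z) :
    fderiv ℝ (fun z => (c z).1) z v = (fderiv ℝ c z v).1 := by
  rw [fderiv.fst hc]; rfl

theorem contDiffAt_fderiv {f : Z → E} {z : Z} (hf : ContDiffAt ℝ ∞ f z) :
    ContDiffAt ℝ ∞ (fderiv ℝ f) z :=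
  hf.fderiv_right (by simp)

theorem contDiffAt_fderiv_apply {f : Z → E} {z : Z} (hf : ContDiffAt ℝ ∞ f z) (v : Z) :
    ContDiffAt ℝ ∞ (fun z => fderiv ℝ f z v) z :=
  (contDiffAt_fderiv hf).clm_apply contDiffAt_const

theorem fderiv_fderiv_apply {f : Z → E} {z : Z} (hf : ContDiffAt ℝ ∞ f z) (v w : Z) :
    fderiv ℝ (fun z => fderiv ℝ f z w) z v = fderiv ℝ (fderiv ℝ f) z v w := by
  rw [fderiv_clm_apply_one ((contDiffAt_fderiv hf).differentiableAt (by simp))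
    (differentiableAt_const w)]
  simp

theorem fderiv_fderiv_symm {f : Z → E} {z : Z} (hf : ContDiffAt ℝ ∞ f z) (v w : Z) :
    fderiv ℝ (fderiv ℝ f) z v w = fderiv ℝ (fderiv ℝ f) z w v :=
  (hf.isSymmSndFDerivAt (by simpa using (WithTop.coe_le_coe.2 le_top : ((2 : ℕ∞) : WithTop ℕ∞) ≤ ∞))) v w

theorem fderiv_fderiv_comm {f : Z → E} {z : Z} (hf : ContDiffAt ℝ ∞ f z) (v w : Z) :
    fderiv ℝ (fun z => fderiv ℝ f z w) z v = fderiv ℝ (fun z => fderiv ℝ f z v) z w := by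
  rw [fderiv_fderiv_apply hf, fderiv_fderiv_apply hf, fderiv_fderiv_symm hf]

/-- `ContinuousLinearMap.flip` as a continuous linear map. -/
def flipL (E F G : Type*) [NormedAddCommGroup E] [NormedSpace ℝ E] [NormedAddCommGroup F]
    [NormedSpace ℝ F] [NormedAddCommGroup G] [NormedSpace ℝ G] :
    (E →L[ℝ] F →L[ℝ] G) →L[ℝ] F →L[ℝ] E →L[ℝ] G :=
  ((ContinuousLinearMap.flipₗᵢ ℝ E F G).toContinuousLinearEquiv :
    (E →L[ℝ] F →L[ℝ] G) →L[ℝ] F →L[ℝ] E →L[ℝ] G)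

theorem fderiv_flip_apply {g : Z → E →L[ℝ] F →L[ℝ] G} {z : Z} (hg : DifferentiableAt ℝ g z)
    (v : Z) (a : F) (b : E) :
    fderiv ℝ (fun z => (g z).flip) z v a b = fderiv ℝ g z v b a := by
  have h := ((flipL E F G).hasFDerivAt.comp z hg.hasFDerivAt).fderiv
  have h' : (fun z => (g z).flip) = flipL E F G ∘ g := rfl
  rw [h', h]; rfl

theorem contDiffAt_flip {g : Z → E →L[ℝ] F →L[ℝ] G} {z : Z} (hg : ContDiffAt ℝ ∞ g z) :
    ContDiffAt ℝ ∞ (fun z => (g z).flip) z :=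
  (flipL E F G).contDiff.contDiffAt.comp z hg

end Calculus

/-! ### Connections along a map into the tangent bundle, and their curvature -/

section Connection

variable {Z E : Type*} [NormedAddCommGroup Z] [NormedSpace ℝ Z]
  [NormedAddCommGroup E] [NormedSpace ℝ E]

/-- Connection coefficients of Berwald type on an open set `Ω` of points `(x, y)`: they are
symmetric, their `y`-derivative is totally symmetric and annihilated by `y`. -/
structure IsBerwald (Γ : E × E → E →L[ℝ] E →L[ℝ] E) (Ω : Set (E × E)) : Prop where
  isOpen : IsOpen Ω
  smooth : ∀ p ∈ Ω, ContDiffAt ℝ ∞ Γ p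
  symm : ∀ p ∈ Ω, ∀ a b, Γ p a b = Γ p b a
  vert_symm : ∀ p ∈ Ω, ∀ u a b, fderiv ℝ Γ p (0, u) a b = fderiv ℝ Γ p (0, a) u b
  vert_self : ∀ p ∈ Ω, ∀ u a, fderiv ℝ Γ p (0, u) a p.2 = 0

/-- The horizontal lift `(a, -Γ(a, y))` of a vector. -/
def horLift (Γ : E × E → E →L[ℝ] E →L[ℝ] E) (p : E × E) : E →L[ℝ] E × E :=
  (ContinuousLinearMap.id ℝ E).prod (-(Γ p).flip p.2)

@[simp] theorem horLift_apply (Γ : E × E → E →L[ℝ] E →L[ℝ] E) (p : E × E) (a : E) :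
    horLift Γ p a = (a, -Γ p a p.2) := rfl

/-- The vertical part of a tangent vector `q` at `p`. -/
def vertPart (Γ : E × E → E →L[ℝ] E →L[ℝ] E) (p q : E × E) : E := q.2 + Γ p q.1 p.2

theorem horLift_add_vertPart (Γ : E × E → E →L[ℝ] E →L[ℝ] E) (p q : E × E) :
    q = horLift Γ p q.1 + (0, vertPart Γ p q) := by
  ext <;> simp [vertPart]

/-- The horizontal derivative part `δΓ(b, c)/δa` of the curvature. -/
def horGamma (Γ : E × E → E →L[ℝ] E →L[ℝ] E) (p : E × E) : E →L[ℝ] E →L[ℝ] E →L[ℝ] E :=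
  (fderiv ℝ Γ p).comp (horLift Γ p)

/-- The quadratic part `Γ(a, Γ(b, c))` of the curvature. -/
def sqGamma (Γ : E × E → E →L[ℝ] E →L[ℝ] E) (p : E × E) : E →L[ℝ] E →L[ℝ] E →L[ℝ] E :=
  ((((ContinuousLinearMap.compL ℝ E E E).comp (Γ p)).flip).comp (Γ p)).flip

/-- The Riemann type curvature. -/
def curv (Γ : E × E → E →L[ℝ] E →L[ℝ] E) (p : E × E) : E →L[ℝ] E →L[ℝ] E →L[ℝ] E :=
  horGamma Γ p - (horGamma Γ p).flip + sqGamma Γ p - (sqGamma Γ p).flip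

theorem curv_apply (Γ : E × E → E →L[ℝ] E →L[ℝ] E) (p : E × E) (a b d : E) :
    curv Γ p a b d = fderiv ℝ Γ p (a, -Γ p a p.2) b d - fderiv ℝ Γ p (b, -Γ p b p.2) a d
      + Γ p a (Γ p b d) - Γ p b (Γ p a d) := rfl

theorem curv_antisymm (Γ : E × E → E →L[ℝ] E →L[ℝ] E) (p : E × E) (a b d : E) :
    curv Γ p a b d = -curv Γ p b a d := by
  simp only [curv_apply]; abel

/-- The covariant derivative of a field `V` along `c = (x, y)` in the direction `v`. -/
def covD (Γ : E × E → E →L[ℝ] E →L[ℝ] E) (c : Z → E × E) (v : Z) (V : Z → E) (z : Z) : E :=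
  fderiv ℝ V z v + Γ (c z) (fderiv ℝ c z v).1 (V z)

variable {Γ : E × E → E →L[ℝ] E →L[ℝ] E} {Ω : Set (E × E)}

theorem contDiffAt_horLift {p : E × E} (hΓ : ContDiffAt ℝ ∞ Γ p) :
    ContDiffAt ℝ ∞ (horLift Γ) p := by
  have h : ContDiffAt ℝ ∞ (fun p => -(Γ p).flip p.2) p :=
    ((contDiffAt_flip hΓ).clm_apply contDiffAt_snd).neg
  have e : horLift Γ = fun p => (ContinuousLinearMap.inl ℝ E E).comp (ContinuousLinearMap.id ℝ E)
      + (ContinuousLinearMap.inr ℝ E E).comp (-(Γ p).flip p.2) := by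
    ext p a <;> simp
  rw [e]
  exact contDiffAt_const.add (contDiffAt_const.clm_comp h)

theorem contDiffAt_horGamma {p : E × E} (hΓ : ContDiffAt ℝ ∞ Γ p) :
    ContDiffAt ℝ ∞ (horGamma Γ) p :=
  (contDiffAt_fderiv hΓ).clm_comp (contDiffAt_horLift hΓ)

theorem contDiffAt_sqGamma {p : E × E} (hΓ : ContDiffAt ℝ ∞ Γ p) :
    ContDiffAt ℝ ∞ (sqGamma Γ) p :=
  contDiffAt_flip ((contDiffAt_flip (contDiffAt_const.clm_comp hΓ)).clm_comp hΓ)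

theorem contDiffAt_curv {p : E × E} (hΓ : ContDiffAt ℝ ∞ Γ p) : ContDiffAt ℝ ∞ (curv Γ) p :=
  (((contDiffAt_horGamma hΓ).sub (contDiffAt_flip (contDiffAt_horGamma hΓ))).add
    (contDiffAt_sqGamma hΓ)).sub (contDiffAt_flip (contDiffAt_sqGamma hΓ))

theorem contDiffAt_covD {c : Z → E × E} {z : Z} {V : Z → E} (hΓ : ContDiffAt ℝ ∞ Γ (c z))
    (hc : ContDiffAt ℝ ∞ c z) (hV : ContDiffAt ℝ ∞ V z) (v : Z) :
    ContDiffAt ℝ ∞ (covD Γ c v V) z :=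
  (contDiffAt_fderiv_apply hV v).add
    (((hΓ.comp z hc).clm_apply (contDiffAt_fderiv_apply hc v).fst).clm_apply hV)

theorem covD_congr {c : Z → E × E} {z : Z} {V V' : Z → E} (h : V =ᶠ[𝓝 z] V') (v : Z) :
    covD Γ c v V z = covD Γ c v V' z := by
  rw [covD, covD, h.fderiv_eq, h.eq_of_nhds]

theorem covD_add {c : Z → E × E} {z : Z} {V V' : Z → E} (hV : ContDiffAt ℝ ∞ V z)
    (hV' : ContDiffAt ℝ ∞ V' z) (v : Z) :
    covD Γ c v (fun z => V z + V' z) z = covD Γ c v V z + covD Γ c v V' z := by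
  rw [covD, covD, covD, fderiv_fun_add (hV.differentiableAt (by simp))
    (hV'.differentiableAt (by simp))]
  simp only [add_apply, map_add]; abel

/-- The full expansion serves twice: its part symmetric in v and w drops out of commutators, and
where V and its derivatives in the directions v and w vanish only the ordinary second derivative
survives. -/
theorem covD_covD {c : Z → E × E} {z : Z} {V : Z → E} (hΓ : ContDiffAt ℝ ∞ Γ (c z))
    (hc : ContDiffAt ℝ ∞ c z) (hV : ContDiffAt ℝ ∞ V z) (v w : Z) :
    covD Γ c v (covD Γ c w V) z
      = fderiv ℝ (fderiv ℝ V) z v w + fderiv ℝ Γ (c z) (fderiv ℝ c z v) (fderiv ℝ c z w).1 (V z)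
        + Γ (c z) (fderiv ℝ (fderiv ℝ c) z v w).1 (V z)
        + Γ (c z) (fderiv ℝ c z w).1 (fderiv ℝ V z v)
        + Γ (c z) (fderiv ℝ c z v).1 (fderiv ℝ V z w)
        + Γ (c z) (fderiv ℝ c z v).1 (Γ (c z) (fderiv ℝ c z w).1 (V z)) := by
  have hc' := contDiffAt_fderiv_apply hc w
  have hcd := hc'.differentiableAt (by simp)
  have hg : ContDiffAt ℝ ∞ (fun z => Γ (c z)) z := hΓ.comp z hc
  have e : covD Γ c w V
      = fun z => fderiv ℝ V z w + Γ (c z) (fderiv ℝ c z w).1 (V z) := rfl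
  rw [covD]
  nth_rewrite 1 [e]
  rw [fderiv_fun_add ((contDiffAt_fderiv_apply hV w).differentiableAt (by simp))
    (((hg.clm_apply hc'.fst).clm_apply hV).differentiableAt (by simp)), add_apply,
    fderiv_fderiv_apply hV,
    fderiv_clm_apply_two (g := fun z => Γ (c z)) (hg.differentiableAt (by simp)) hcd.fst
      (hV.differentiableAt (by simp)),
    fderiv_comp_apply (hΓ.differentiableAt (by simp)) (hc.differentiableAt (by simp)),
    fderiv_fst_apply hcd, fderiv_fderiv_apply hc]
  simp only [covD, map_add]
  abel

/-- The curvature of the connection as the commutator of covariant derivatives. -/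
theorem covD_covD_comm {c : Z → E × E} {z : Z} {V : Z → E} (hΓ : ContDiffAt ℝ ∞ Γ (c z))
    (hc : ContDiffAt ℝ ∞ c z) (hV : ContDiffAt ℝ ∞ V z) (v w : Z) :
    covD Γ c v (covD Γ c w V) z = covD Γ c w (covD Γ c v V) z
      + curv Γ (c z) (fderiv ℝ c z v).1 (fderiv ℝ c z w).1 (V z)
      + fderiv ℝ Γ (c z) (0, vertPart Γ (c z) (fderiv ℝ c z v)) (fderiv ℝ c z w).1 (V z)
      - fderiv ℝ Γ (c z) (0, vertPart Γ (c z) (fderiv ℝ c z w)) (fderiv ℝ c z v).1 (V z) := by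
  rw [covD_covD hΓ hc hV, covD_covD hΓ hc hV, curv_apply, fderiv_fderiv_symm hV w v,
    fderiv_fderiv_symm hc w v]
  -- Splitting the velocity of c: the horizontal part feeds the curvature, the vertical part gives
  -- the remaining terms.
  have h (u : Z) (a b : E) : fderiv ℝ Γ (c z) (fderiv ℝ c z u) a b
      = fderiv ℝ Γ (c z) ((fderiv ℝ c z u).1, -Γ (c z) (fderiv ℝ c z u).1 (c z).2) a b
        + fderiv ℝ Γ (c z) (0, vertPart Γ (c z) (fderiv ℝ c z u)) a b := by
    conv_lhs => rw [horLift_add_vertPart Γ (c z) (fderiv ℝ c z u), map_add]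
    rfl
  rw [h v, h w]
  abel

/-- The horizontal covariant derivative of a tensor of type `(1, 3)`. -/
def horCovC (Γ : E × E → E →L[ℝ] E →L[ℝ] E) (T : E × E → E →L[ℝ] E →L[ℝ] E →L[ℝ] E) (p : E × E)
    (w a b d : E) : E :=
  fderiv ℝ T p (w, -Γ p w p.2) a b d + Γ p w (T p a b d) - T p (Γ p w a) b d
    - T p a (Γ p w b) d - T p a b (Γ p w d)

/-- The Leibniz rule for covariant derivatives. -/
theorem covD_tensor {T : E × E → E →L[ℝ] E →L[ℝ] E →L[ℝ] E} {c : Z → E × E} {z : Z}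
    {A B D : Z → E} (hT : ContDiffAt ℝ ∞ T (c z)) (hc : ContDiffAt ℝ ∞ c z)
    (hA : ContDiffAt ℝ ∞ A z) (hB : ContDiffAt ℝ ∞ B z) (hD : ContDiffAt ℝ ∞ D z) (v : Z) :
    covD Γ c v (fun z => T (c z) (A z) (B z) (D z)) z
      = horCovC Γ T (c z) (fderiv ℝ c z v).1 (A z) (B z) (D z)
        + fderiv ℝ T (c z) (0, vertPart Γ (c z) (fderiv ℝ c z v)) (A z) (B z) (D z)
        + T (c z) (covD Γ c v A z) (B z) (D z) + T (c z) (A z) (covD Γ c v B z) (D z)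
        + T (c z) (A z) (B z) (covD Γ c v D z) := by
  have h (a b d : E) : fderiv ℝ T (c z) (fderiv ℝ c z v) a b d
      = fderiv ℝ T (c z) ((fderiv ℝ c z v).1, -Γ (c z) (fderiv ℝ c z v).1 (c z).2) a b d
        + fderiv ℝ T (c z) (0, vertPart Γ (c z) (fderiv ℝ c z v)) a b d := by
    conv_lhs => rw [horLift_add_vertPart Γ (c z) (fderiv ℝ c z v), map_add]
    rfl
  simp only [covD, horCovC]
  rw [fderiv_clm_apply_three (g := fun z => T (c z)) ((hT.comp z hc).differentiableAt (by simp))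
    (hA.differentiableAt (by simp)) (hB.differentiableAt (by simp))
    (hD.differentiableAt (by simp)),
    fderiv_comp_apply (hT.differentiableAt (by simp)) (hc.differentiableAt (by simp)), h]
  simp only [map_add, add_apply]
  abel

theorem fderiv_curv_antisymm {p : E × E} (hΓ : ContDiffAt ℝ ∞ Γ p) (w : E × E) (a b d : E) :
    fderiv ℝ (curv Γ) p w a b d = -fderiv ℝ (curv Γ) p w b a d := by
  have e : curv Γ = fun q => -(curv Γ q).flip := by
    ext q a b d; exact curv_antisymm Γ q a b d
  have hf := fderiv_flip_apply ((contDiffAt_curv hΓ).differentiableAt (by simp)) w a b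
  conv_lhs => rw [e]
  rw [fderiv_fun_neg]
  simp only [neg_apply]
  rw [hf]

theorem horCovC_curv_antisymm {p : E × E} (hΓ : ContDiffAt ℝ ∞ Γ p) (w a b d : E) :
    horCovC Γ (curv Γ) p w a b d = -horCovC Γ (curv Γ) p w b a d := by
  simp only [horCovC]
  rw [fderiv_curv_antisymm hΓ, curv_antisymm Γ p a b d, curv_antisymm Γ p (Γ p w a) b d,
    curv_antisymm Γ p a (Γ p w b) d, curv_antisymm Γ p a b (Γ p w d), map_neg]
  abel

/-! ### Identities special to Berwald type coefficients -/

namespace IsBerwald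

variable (h : IsBerwald Γ Ω) {p : E × E} (hp : p ∈ Ω)
include h hp

theorem fderiv_symm (w : E × E) (a b : E) : fderiv ℝ Γ p w a b = fderiv ℝ Γ p w b a := by
  rw [← fderiv_flip_apply ((h.smooth p hp).differentiableAt (by simp))]
  have : Γ =ᶠ[𝓝 p] fun q => (Γ q).flip :=
    Filter.eventuallyEq_of_mem (h.isOpen.mem_nhds hp) fun q hq => by
      ext a b; exact h.symm q hq a b
  rw [← this.fderiv_eq]

/-- The first Bianchi identity. -/
theorem bianchi (a b d : E) : curv Γ p a b d + curv Γ p b d a + curv Γ p d a b = 0 := by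
  simp only [curv_apply]
  rw [h.symm p hp b d, h.symm p hp a d, h.symm p hp b a, h.fderiv_symm hp _ b d,
    h.fderiv_symm hp _ a d, h.fderiv_symm hp _ b a]
  abel

theorem vert_self' (u a : E) : fderiv ℝ Γ p (0, u) p.2 a = 0 := by
  rw [h.fderiv_symm hp, h.vert_self p hp]

/-- Differentiating the identity `∂_u Γ(a, y) = 0`, valid on an open set, moves the derivative onto
y. -/
theorem vert_self_fderiv (w : E × E) (u a : E) :
    fderiv ℝ (fderiv ℝ Γ) p w (0, u) a p.2 = -fderiv ℝ Γ p (0, u) a w.2 := by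
  have e : (fun q => fderiv ℝ Γ q (0, u) a q.2) =ᶠ[𝓝 p] fun _ => (0 : E) :=
    Filter.eventuallyEq_of_mem (h.isOpen.mem_nhds hp) fun q hq => h.vert_self q hq u a
  have e' := congrArg (fun f : E × E →L[ℝ] E => f w) e.fderiv_eq
  rw [fderiv_clm_apply_three (E := E × E) (F := E) (G := E) (H := E) (g := fderiv ℝ Γ)
    (a := fun _ => ((0 : E), u))
    (b := fun _ => a)
    (d := fun q : E × E => q.2)
    ((contDiffAt_fderiv (h.smooth p hp)).differentiableAt (by simp))
    (differentiableAt_const _) (differentiableAt_const _) differentiableAt_snd] at e'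
  simp [fderiv_snd] at e'
  exact eq_neg_of_add_eq_zero_left e'

/-- The vertical derivative of the curvature vanishes when the last argument is `y`. -/
theorem fderiv_curv_self (v a b : E) : fderiv ℝ (curv Γ) p (0, v) a b p.2 = 0 := by
  have hΓ := h.smooth p hp
  have dΓ : DifferentiableAt ℝ Γ p := hΓ.differentiableAt (by simp)
  have dΓ' := (contDiffAt_fderiv hΓ).differentiableAt (by simp)
  have dh (a : E) : DifferentiableAt ℝ (fun q : E × E => (a, -Γ q a q.2)) p :=
    (differentiableAt_const a).prodMk
      ((dΓ.clm_apply (differentiableAt_const a)).clm_apply differentiableAt_snd).neg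
  have dc (a : E) : DifferentiableAt ℝ (fun _ : E × E => a) p := differentiableAt_const a
  -- The last argument is frozen at the value of y at p, so that only the curvature itself is
  -- differentiated.
  have e : fderiv ℝ (curv Γ) p (0, v) a b p.2
      = fderiv ℝ (fun q => curv Γ q a b p.2) p (0, v) := by
    rw [fderiv_clm_apply_three ((contDiffAt_curv hΓ).differentiableAt (by simp)) (dc a) (dc b)
      (dc p.2)]
    simp
  have hd (a : E) : fderiv ℝ (fun q : E × E => (a, -Γ q a q.2)) p (0, v)
      = (0, -fderiv ℝ Γ p (0, v) a p.2 - Γ p a v) := by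
    rw [(differentiableAt_const a).fderiv_prodMk
      ((dΓ.clm_apply (differentiableAt_const a)).clm_apply differentiableAt_snd).fun_neg]
    ext
    · simp
    · simp only [ContinuousLinearMap.prod_apply]
      rw [fderiv_fun_neg, neg_apply, fderiv_clm_apply_two dΓ (dc a) differentiableAt_snd]
      simp [fderiv_snd]; abel
  -- The contribution of the derivative of Γ at (a, b) equals that of the quadratic part at (b, a),
  -- so everything cancels on antisymmetrizing.
  have t1 (a b : E) : fderiv ℝ (fun q : E × E => fderiv ℝ Γ q (a, -Γ q a q.2) b p.2) p (0, v)
      = fderiv ℝ Γ p (0, v) b (Γ p a p.2) := by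
    rw [fderiv_clm_apply_three dΓ' (dh a) (dc b) (dc p.2), hd, fderiv_fderiv_symm hΓ,
      h.vert_self_fderiv hp, h.vert_self p hp]
    simp
  have t2 (a b : E) : fderiv ℝ (fun q : E × E => Γ q a (Γ q b p.2)) p (0, v)
      = fderiv ℝ Γ p (0, v) a (Γ p b p.2) := by
    rw [fderiv_clm_apply_two dΓ (dc a) ((dΓ.clm_apply (dc b)).clm_apply (dc p.2)),
      fderiv_clm_apply_two dΓ (dc b) (dc p.2), h.vert_self p hp]
    simp
  rw [e]
  simp only [curv_apply]
  have d1 (a b : E) := (dΓ'.clm_apply (dh a)).clm_apply (dc b) |>.clm_apply (dc p.2)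
  have d2 (a b : E) := (dΓ.clm_apply (dc a)).clm_apply ((dΓ.clm_apply (dc b)).clm_apply (dc p.2))
  rw [fderiv_fun_sub (((d1 a b).fun_sub (d1 b a)).fun_add (d2 a b)) (d2 b a),
    fderiv_fun_add ((d1 a b).fun_sub (d1 b a)) (d2 a b), fderiv_fun_sub (d1 a b) (d1 b a)]
  simp only [sub_apply, add_apply, t1, t2]
  abel

end IsBerwald

/-! ### Derivatives of the acceleration of a surface -/

section Deviation

/-- The lift `(x, ∂x/∂t)` of a map `x` to the tangent bundle. -/
def velLift (x : Z → E) (t : Z) (z : Z) : E × E := (x z, fderiv ℝ x z t)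

/-- The acceleration `D_t ∂x/∂t`. -/
def accel (Γ : E × E → E →L[ℝ] E →L[ℝ] E) (x : Z → E) (t : Z) : Z → E :=
  covD Γ (velLift x t) t fun z => fderiv ℝ x z t

variable {x : Z → E} {t : Z} {z : Z}

theorem contDiffAt_velLift (hx : ContDiffAt ℝ ∞ x z) : ContDiffAt ℝ ∞ (velLift x t) z :=
  hx.prodMk (contDiffAt_fderiv_apply hx t)

theorem fderiv_velLift (hx : ContDiffAt ℝ ∞ x z) (v : Z) :
    fderiv ℝ (velLift x t) z v = (fderiv ℝ x z v, fderiv ℝ (fun z => fderiv ℝ x z t) z v) := by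
  have e : velLift x t = fun z => (x z, fderiv ℝ x z t) := rfl
  rw [e, (hx.differentiableAt (by simp)).fderiv_prodMk
    ((contDiffAt_fderiv_apply hx t).differentiableAt (by simp))]
  rfl

/-- For v = t this vertical part is the acceleration, so the velocity lift of a geodesic is
horizontal. -/
theorem vertPart_velLift (hx : ContDiffAt ℝ ∞ x z) (v : Z) :
    vertPart Γ (velLift x t z) (fderiv ℝ (velLift x t) z v)
      = covD Γ (velLift x t) v (fun z => fderiv ℝ x z t) z := by
  rw [vertPart, covD, fderiv_velLift hx]; rfl

/-- The connection has no torsion. -/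
theorem covD_velLift_symm (h : IsBerwald Γ Ω) (hz : velLift x t z ∈ Ω) (hx : ContDiffAt ℝ ∞ x z)
    (v w : Z) : covD Γ (velLift x t) v (fun z => fderiv ℝ x z w) z
      = covD Γ (velLift x t) w (fun z => fderiv ℝ x z v) z := by
  rw [covD, covD, fderiv_velLift hx, fderiv_velLift hx, fderiv_fderiv_comm hx v w,
    h.symm _ hz]

theorem contDiffAt_accel (h : IsBerwald Γ Ω) (hz : velLift x t z ∈ Ω) (hx : ContDiffAt ℝ ∞ x z) :
    ContDiffAt ℝ ∞ (accel Γ x t) z :=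
  contDiffAt_covD (h.smooth _ hz) (contDiffAt_velLift hx) (contDiffAt_fderiv_apply hx t) t

/-- The covariant derivative of the acceleration in a transversal direction. -/
theorem covD_accel (h : IsBerwald Γ Ω) {W : Set Z} (hW : IsOpen W)
    (hx : ∀ z ∈ W, ContDiffAt ℝ ∞ x z) (hxΩ : ∀ z ∈ W, velLift x t z ∈ Ω) (e : Z) (hz : z ∈ W) :
    covD Γ (velLift x t) e (accel Γ x t) z
      = covD Γ (velLift x t) t (covD Γ (velLift x t) t fun z => fderiv ℝ x z e) z
        + curv Γ (velLift x t z) (fderiv ℝ x z e) (fderiv ℝ x z t) (fderiv ℝ x z t) := by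
  have hp := hxΩ z hz
  -- The absence of torsion is needed on a neighbourhood, because it is differentiated once more.
  have hc : covD Γ (velLift x t) e (fun z => fderiv ℝ x z t) =ᶠ[𝓝 z]
      covD Γ (velLift x t) t fun z => fderiv ℝ x z e :=
    Filter.eventuallyEq_of_mem (hW.mem_nhds hz) fun w hw =>
      covD_velLift_symm h (hxΩ w hw) (hx w hw) e t
  rw [accel, covD_covD_comm (h.smooth _ hp) (contDiffAt_velLift (hx z hz))
    (contDiffAt_fderiv_apply (hx z hz) t), covD_congr hc, fderiv_velLift (hx z hz),
    fderiv_velLift (hx z hz)]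
  -- Both vertical terms of the commutator have the velocity as last argument, hence vanish.
  have h0 (u a : E) : fderiv ℝ Γ (velLift x t z) (0, u) a (fderiv ℝ x z t) = 0 :=
    h.vert_self _ hp u a
  rw [h0, h0]
  abel

/-- One vertical term of the commutator contains the velocity as an argument and vanishes. The other
is linear in the acceleration, so it disappears later on the central geodesic. -/
theorem covD_covD_transversal (h : IsBerwald Γ Ω) (hz : velLift x t z ∈ Ω)
    (hx : ContDiffAt ℝ ∞ x z) {V : Z → E} (hV : ContDiffAt ℝ ∞ V z) (e : Z) :
    covD Γ (velLift x t) e (covD Γ (velLift x t) t V) z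
      = covD Γ (velLift x t) t (covD Γ (velLift x t) e V) z
        + curv Γ (velLift x t z) (fderiv ℝ x z e) (fderiv ℝ x z t) (V z)
        - fderiv ℝ Γ (velLift x t z) (0, accel Γ x t z) (fderiv ℝ x z e) (V z) := by
  have h0 (u a : E) : fderiv ℝ Γ (velLift x t z) (0, u) (fderiv ℝ x z t) a = 0 :=
    h.vert_self' hz u a
  rw [covD_covD_comm (h.smooth _ hz) (contDiffAt_velLift hx) hV, vertPart_velLift hx,
    vertPart_velLift hx, fderiv_velLift hx, fderiv_velLift hx, h0, accel]
  abel

/-- The second derivative of the acceleration at a point where the acceleration and its first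
derivatives vanish. -/
theorem fderiv_fderiv_accel (h : IsBerwald Γ Ω) {W : Set Z} (hW : IsOpen W)
    (hx : ∀ z ∈ W, ContDiffAt ℝ ∞ x z) (hxΩ : ∀ z ∈ W, velLift x t z ∈ Ω) (e : Z) (hz : z ∈ W)
    (h0 : accel Γ x t z = 0) (ht : fderiv ℝ (accel Γ x t) z t = 0)
    (he : fderiv ℝ (accel Γ x t) z e = 0) :
    fderiv ℝ (fderiv ℝ (accel Γ x t)) z e e
      = covD Γ (velLift x t) t (covD Γ (velLift x t) t
          (covD Γ (velLift x t) e fun z => fderiv ℝ x z e)) z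
        + curv Γ (velLift x t z) (covD Γ (velLift x t) e (fun z => fderiv ℝ x z e) z)
            (fderiv ℝ x z t) (fderiv ℝ x z t)
        - (horCovC Γ (curv Γ) (velLift x t z) (fderiv ℝ x z e) (fderiv ℝ x z t)
              (fderiv ℝ x z e) (fderiv ℝ x z t)
          + horCovC Γ (curv Γ) (velLift x t z) (fderiv ℝ x z t) (fderiv ℝ x z t)
              (fderiv ℝ x z e) (fderiv ℝ x z e)
          + (4 : ℝ) • curv Γ (velLift x t z) (fderiv ℝ x z t) (fderiv ℝ x z e)
              (covD Γ (velLift x t) t (fun z => fderiv ℝ x z e) z)) := by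
  have hp := hxΩ z hz
  have hΓ (w : Z) (hw : w ∈ W) : ContDiffAt ℝ ∞ Γ (velLift x t w) := h.smooth _ (hxΩ w hw)
  have hR := contDiffAt_curv (hΓ z hz)
  have hc (w : Z) (hw : w ∈ W) : ContDiffAt ℝ ∞ (velLift x t) w := contDiffAt_velLift (hx w hw)
  have hξ (w : Z) (hw : w ∈ W) (v : Z) : ContDiffAt ℝ ∞ (fun z => fderiv ℝ x z v) w :=
    contDiffAt_fderiv_apply (hx w hw) v
  have hD (w : Z) (hw : w ∈ W) (V : Z → E) (hV : ContDiffAt ℝ ∞ V w) (v : Z) :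
      ContDiffAt ℝ ∞ (covD Γ (velLift x t) v V) w := contDiffAt_covD (hΓ w hw) (hc w hw) hV v
  have hA := contDiffAt_accel h hp (hx z hz)
  have hRc : ContDiffAt ℝ ∞ (fun z => curv Γ (velLift x t z)) z := hR.comp z (hc z hz)
  have hRξ (v : Z) : ContDiffAt ℝ ∞ (fun z => curv Γ (velLift x t z) (fderiv ℝ x z e)
      (fderiv ℝ x z t) (fderiv ℝ x z v)) z :=
    ((hRc.clm_apply (hξ z hz e)).clm_apply (hξ z hz t)).clm_apply (hξ z hz v)
  -- the second covariant derivative of the acceleration is the ordinary one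
  have s1 : covD Γ (velLift x t) e (covD Γ (velLift x t) e (accel Γ x t)) z
      = fderiv ℝ (fderiv ℝ (accel Γ x t)) z e e := by
    rw [covD_covD (hΓ z hz) (hc z hz) hA, h0, he]
    simp
  have s2 : covD Γ (velLift x t) e (covD Γ (velLift x t) e (accel Γ x t)) z
      = covD Γ (velLift x t) e (covD Γ (velLift x t) t (covD Γ (velLift x t) t
          fun z => fderiv ℝ x z e)) z
        + covD Γ (velLift x t) e (fun z => curv Γ (velLift x t z) (fderiv ℝ x z e)
            (fderiv ℝ x z t) (fderiv ℝ x z t)) z := by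
    rw [← covD_add (hD z hz _ (hD z hz _ (hξ z hz e) t) t) (hRξ t)]
    exact covD_congr (Filter.eventuallyEq_of_mem (hW.mem_nhds hz) fun w hw =>
      covD_accel h hW hx hxΩ e hw) e
  -- Here the transversal derivative passes the outer t-derivative; in `s4` it passes the inner one.
  have s3 := covD_covD_transversal h hp (hx z hz) (hD z hz _ (hξ z hz e) t) e
  have hQ : ContDiffAt ℝ ∞ (fun z => fderiv ℝ Γ (velLift x t z) (0, accel Γ x t z)
      (fderiv ℝ x z e) (fderiv ℝ x z e)) z :=
    ((((contDiffAt_fderiv (hΓ z hz)).comp z (hc z hz)).clm_apply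
      (contDiffAt_const.prodMk hA)).clm_apply (hξ z hz e)).clm_apply (hξ z hz e)
  have s4 : covD Γ (velLift x t) t (covD Γ (velLift x t) e (covD Γ (velLift x t) t
          fun z => fderiv ℝ x z e)) z
      = covD Γ (velLift x t) t (covD Γ (velLift x t) t (covD Γ (velLift x t) e
          fun z => fderiv ℝ x z e)) z
        + covD Γ (velLift x t) t (fun z => curv Γ (velLift x t z) (fderiv ℝ x z e)
            (fderiv ℝ x z t) (fderiv ℝ x z e)) z
        + covD Γ (velLift x t) t (fun z => -fderiv ℝ Γ (velLift x t z) (0, accel Γ x t z)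
            (fderiv ℝ x z e) (fderiv ℝ x z e)) z := by
    have hd := hD z hz _ (hD z hz _ (hξ z hz e) e) t
    rw [← covD_add hd (hRξ e), ← covD_add (hd.add (hRξ e)) hQ.neg]
    refine covD_congr (Filter.eventuallyEq_of_mem (hW.mem_nhds hz) fun w hw => ?_) t
    rw [covD_covD_transversal h (hxΩ w hw) (hx w hw) (hξ w hw e)]
    abel
  -- The acceleration and its t-derivative both vanish at z, so a term linear in the acceleration
  -- has vanishing covariant t-derivative.
  have s5 : covD Γ (velLift x t) t (fun z => -fderiv ℝ Γ (velLift x t z) (0, accel Γ x t z)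
      (fderiv ℝ x z e) (fderiv ℝ x z e)) z = 0 := by
    have hA0 : fderiv ℝ (fun z => ((0 : E), accel Γ x t z)) z t = 0 := by
      rw [(differentiableAt_const (0 : E)).fderiv_prodMk (hA.differentiableAt (by simp))]
      ext
      · simp
      · exact ht
    rw [covD, fderiv_fun_neg, neg_apply, fderiv_clm_apply_three
      (g := fun z => fderiv ℝ Γ (velLift x t z))
      (((contDiffAt_fderiv (hΓ z hz)).comp z (hc z hz)).differentiableAt (by simp))
      ((contDiffAt_const.prodMk hA).differentiableAt (by simp))
      ((hξ z hz e).differentiableAt (by simp)) ((hξ z hz e).differentiableAt (by simp)), hA0, h0]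
    have : ((0 : E), (0 : E)) = 0 := rfl
    simp [this]
  -- This removes the vertical derivative of the curvature in the t-direction. In the e-direction
  -- the vertical part is D, and `hk` uses homogeneity instead.
  have hv : vertPart Γ (velLift x t z) (fderiv ℝ (velLift x t) z t) = 0 := by
    rw [vertPart_velLift (hx z hz)]; exact h0
  have h00 : ((0 : E), (0 : E)) = 0 := rfl
  have hy : covD Γ (velLift x t) t (fun z => fderiv ℝ x z t) z = 0 := h0
  have s6 := covD_tensor (Γ := Γ) hR (hc z hz) (hξ z hz e) (hξ z hz t) (hξ z hz e) t
  have s7 := covD_tensor (Γ := Γ) hR (hc z hz) (hξ z hz e) (hξ z hz t) (hξ z hz t) e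
  have hk (v : E) : fderiv ℝ (curv Γ) (velLift x t z) (0, v) (fderiv ℝ x z e) (fderiv ℝ x z t)
      (fderiv ℝ x z t) = 0 := h.fderiv_curv_self hp v _ _
  rw [hv, h00, hy, fderiv_velLift (hx z hz)] at s6
  rw [hk, covD_velLift_symm h hp (hx z hz) e t, fderiv_velLift (hx z hz)] at s7
  rw [h0, h00] at s3
  simp only [map_zero, zero_apply, add_zero, sub_zero] at s6 s7 s3
  -- The Leibniz rule and the commutators yield 3 R(ξ, T)D + R(ξ, D)T + R(D, T)ξ; by Bianchi the
  -- last two terms sum to R(ξ, T)D, whence the constant 4.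
  have hb := h.bianchi hp (fderiv ℝ x z t) (fderiv ℝ x z e)
    (covD Γ (velLift x t) t (fun z => fderiv ℝ x z e) z)
  rw [← s1, s2, s3, s4, s5, s6, s7, horCovC_curv_antisymm (hΓ z hz) _ (fderiv ℝ x z e),
    horCovC_curv_antisymm (hΓ z hz) _ (fderiv ℝ x z e),
    curv_antisymm Γ _ (fderiv ℝ x z e) (fderiv ℝ x z t)]
  refine sub_eq_zero.1 (Eq.trans ?_ hb)
  module

end Deviation

end Connection

/-! ### Homogeneity of the spray and comparison with the chart definitions -/

section SprayCoefficients

variable {n : ℕ}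

/-- The points `(x, y)` with `x ∈ U` and `y ≠ 0`. -/
def slitOver (U : Set (Coord n)) : Set (Coord n × Coord n) := {p | p.1 ∈ U ∧ p.2 ≠ 0}

/-- `F` is smooth and positively homogeneous of degree two in `y` on `U × (ℝⁿ ∖ 0)`. -/
structure IsSprayCoeff (F : Coord n × Coord n → Coord n) (U : Set (Coord n)) : Prop where
  isOpen : IsOpen U
  smooth : ∀ p ∈ slitOver U, ContDiffAt ℝ ∞ F p
  homogeneous : ∀ p ∈ slitOver U, ∀ k : ℝ, 0 < k → F (p.1, k • p.2) = k ^ 2 • F p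

/-- The connection coefficients as a function with values in bilinear maps. -/
def gam (F : Coord n × Coord n → Coord n) (p : Coord n × Coord n) :
    Coord n →L[ℝ] Coord n →L[ℝ] Coord n :=
  (1 / 2 : ℝ) • (((fderiv ℝ (fderiv ℝ F) p).comp
    (ContinuousLinearMap.inr ℝ (Coord n) (Coord n))).flip.comp
      (ContinuousLinearMap.inr ℝ (Coord n) (Coord n)))

variable {F : Coord n × Coord n → Coord n} {U : Set (Coord n)} {p : Coord n × Coord n}

theorem gam_apply (F : Coord n × Coord n → Coord n) (p : Coord n × Coord n) (a b : Coord n) :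
    gam F p a b = (1 / 2 : ℝ) • fderiv ℝ (fderiv ℝ F) p (0, b) (0, a) := rfl

theorem contDiffAt_gam (hF : ContDiffAt ℝ ∞ F p) : ContDiffAt ℝ ∞ (gam F) p := by
  have h : ContDiffAt ℝ ∞ (fun p => ((fderiv ℝ (fderiv ℝ F) p).comp
      (ContinuousLinearMap.inr ℝ (Coord n) (Coord n))).flip.comp
        (ContinuousLinearMap.inr ℝ (Coord n) (Coord n))) p :=
    (contDiffAt_flip ((contDiffAt_fderiv (contDiffAt_fderiv hF)).clm_comp
      contDiffAt_const)).clm_comp contDiffAt_const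
  exact h.const_smul (1 / 2 : ℝ)

theorem fderiv_gam_apply (hF : ContDiffAt ℝ ∞ F p) (w : Coord n × Coord n) (a b : Coord n) :
    fderiv ℝ (gam F) p w a b
      = (1 / 2 : ℝ) • fderiv ℝ (fderiv ℝ (fderiv ℝ F)) p w (0, b) (0, a) := by
  have h1 : fderiv ℝ (fun q => gam F q a b) p w = fderiv ℝ (gam F) p w a b := by
    rw [fderiv_clm_apply_two ((contDiffAt_gam hF).differentiableAt (by simp))
      (differentiableAt_const a) (differentiableAt_const b)]
    simp
  have d2 : DifferentiableAt ℝ (fderiv ℝ (fderiv ℝ F)) p :=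
    (contDiffAt_fderiv (contDiffAt_fderiv hF)).differentiableAt (by simp)
  rw [← h1]
  simp only [gam_apply]
  rw [fderiv_fun_const_smul ((d2.clm_apply (differentiableAt_const _)).clm_apply
    (differentiableAt_const _)), smul_apply, fderiv_clm_apply_two d2
      (differentiableAt_const ((0 : Coord n), b)) (differentiableAt_const ((0 : Coord n), a))]
  simp

theorem christoffel_eq (hF : ContDiffAt ℝ ∞ F p) (a b : Coord n) :
    christoffel F p a b = gam F p a b := by
  have h := contDiffAt_fderiv_apply hF ((0 : Coord n), a)
  simp only [christoffel, nonlinConn]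
  rw [fderiv_fun_const_smul (h.differentiableAt (by simp)), smul_apply,
    fderiv_fderiv_apply hF, gam_apply]

theorem fderiv_zero_prodMk_snd (w : Coord n × Coord n) :
    fderiv ℝ (fun q : Coord n × Coord n => ((0 : Coord n), q.2)) p w = (0, w.2) := by
  rw [(differentiableAt_const (0 : Coord n)).fderiv_prodMk differentiableAt_snd]
  simp [fderiv_snd]

/-- The second derivative is symmetric near p, and differentiation preserves this. -/
theorem fderiv_three_symm (hF : ∀ᶠ q in 𝓝 p, ContDiffAt ℝ ∞ F q) (u v w : Coord n × Coord n) :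
    fderiv ℝ (fderiv ℝ (fderiv ℝ F)) p u v w = fderiv ℝ (fderiv ℝ (fderiv ℝ F)) p u w v := by
  rw [← fderiv_flip_apply ((contDiffAt_fderiv (contDiffAt_fderiv
    hF.self_of_nhds)).differentiableAt (by simp))]
  have : fderiv ℝ (fderiv ℝ F) =ᶠ[𝓝 p] fun q => (fderiv ℝ (fderiv ℝ F) q).flip := by
    filter_upwards [hF] with q hq
    exact ContinuousLinearMap.ext fun a => ContinuousLinearMap.ext fun b =>
      fderiv_fderiv_symm hq a b
  rw [← this.fderiv_eq]

namespace IsSprayCoeff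

variable (hF : IsSprayCoeff F U)
include hF

theorem isOpen_slitOver : IsOpen (slitOver U) :=
  (hF.isOpen.preimage continuous_fst).inter (isOpen_compl_singleton.preimage continuous_snd)

variable (hp : p ∈ slitOver U)
include hp

theorem eventually_mem : ∀ᶠ q in 𝓝 p, q ∈ slitOver U := hF.isOpen_slitOver.mem_nhds hp

/-- Euler's identity: differentiate the homogeneity relation in k at k = 1. -/
theorem fderiv_self : fderiv ℝ F p (0, p.2) = (2 : ℝ) • F p := by
  have hd : HasFDerivAt F (fderiv ℝ F p) (p.1, (1 : ℝ) • p.2) := by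
    rw [one_smul]; exact ((hF.smooth p hp).differentiableAt (by simp)).hasFDerivAt
  have h1 : HasDerivAt (fun k : ℝ => (p.1, k • p.2)) ((0 : Coord n), p.2) 1 := by
    have := (hasDerivAt_const (1 : ℝ) p.1).prodMk ((hasDerivAt_id (1 : ℝ)).smul_const p.2)
    simpa using this
  have h2 := hd.comp_hasDerivAt (1 : ℝ) h1
  have h3 : HasDerivAt (fun k : ℝ => k ^ 2 • F p) ((2 : ℝ) • F p) 1 := by
    have := ((hasDerivAt_pow 2 (1 : ℝ))).smul_const (F p)
    simpa using this
  have e : (F ∘ fun k : ℝ => (p.1, k • p.2)) =ᶠ[𝓝 1] fun k => k ^ 2 • F p := by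
    filter_upwards [lt_mem_nhds (zero_lt_one (α := ℝ))] with k hk
    exact hF.homogeneous p hp k hk
  exact h2.unique (h3.congr_of_eventuallyEq e)

/-- Euler's identity in degree one, obtained by differentiating the previous one along the fibre. -/
theorem fderiv_fderiv_self (u : Coord n) :
    fderiv ℝ (fderiv ℝ F) p (0, u) (0, p.2) = fderiv ℝ F p (0, u) := by
  have hs := hF.smooth p hp
  have e : (fun q => fderiv ℝ F q (0, q.2)) =ᶠ[𝓝 p] fun q => (2 : ℝ) • F q := by
    filter_upwards [hF.eventually_mem hp] with q hq using hF.fderiv_self hq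
  have h := congrArg (fun f : Coord n × Coord n →L[ℝ] Coord n => f (0, u)) e.fderiv_eq
  rw [fderiv_clm_apply_one ((contDiffAt_fderiv hs).differentiableAt (by simp))
    ((differentiableAt_const (0 : Coord n)).prodMk differentiableAt_snd),
    fderiv_zero_prodMk_snd, fderiv_fun_const_smul (hs.differentiableAt (by simp)), two_smul ℝ (fderiv ℝ F p)] at h
  simpa [fderiv_snd] using h

/-- Euler's identity in degree zero; it makes vertical derivatives of Γ annihilate y. -/
theorem fderiv_three_self (u v : Coord n) :
    fderiv ℝ (fderiv ℝ (fderiv ℝ F)) p (0, u) (0, v) (0, p.2) = 0 := by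
  have hs := hF.smooth p hp
  have e : (fun q => fderiv ℝ (fderiv ℝ F) q (0, v) (0, q.2))
      =ᶠ[𝓝 p] fun q => fderiv ℝ F q (0, v) := by
    filter_upwards [hF.eventually_mem hp] with q hq using hF.fderiv_fderiv_self hq v
  have h := congrArg (fun f : Coord n × Coord n →L[ℝ] Coord n => f (0, u)) e.fderiv_eq
  rw [fderiv_clm_apply_two
    ((contDiffAt_fderiv (contDiffAt_fderiv hs)).differentiableAt (by simp))
    (differentiableAt_const _)
    ((differentiableAt_const (0 : Coord n)).prodMk differentiableAt_snd),
    fderiv_zero_prodMk_snd, fderiv_fderiv_apply hs, fderiv_fderiv_symm hs (0, u) (0, v)] at h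
  simpa [fderiv_snd] using h

/-- By Euler's identity the horizontal lift of the spray is `horLift` of its coefficients. -/
theorem nonlinConn_eq (a : Coord n) : nonlinConn F p a = gam F p a p.2 := by
  rw [nonlinConn, gam_apply, fderiv_fderiv_symm (hF.smooth p hp), hF.fderiv_fderiv_self hp]

theorem gam_self : gam F p p.2 p.2 = F p := by
  rw [gam_apply, hF.fderiv_fderiv_self hp, hF.fderiv_self hp, smul_smul]
  norm_num

omit hp in
theorem isBerwald : IsBerwald (gam F) (slitOver U) where
  isOpen := hF.isOpen_slitOver
  smooth p hp := contDiffAt_gam (hF.smooth p hp)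
  symm p hp a b := by rw [gam_apply, gam_apply, fderiv_fderiv_symm (hF.smooth p hp)]
  vert_symm p hp u a b := by
    have hs := hF.smooth p hp
    have he : ∀ᶠ q in 𝓝 p, ContDiffAt ℝ ∞ F q := (hF.eventually_mem hp).mono hF.smooth
    rw [fderiv_gam_apply hs, fderiv_gam_apply hs, fderiv_fderiv_symm (contDiffAt_fderiv hs),
      fderiv_three_symm he, fderiv_fderiv_symm (contDiffAt_fderiv hs)]
  vert_self p hp u a := by
    have he : ∀ᶠ q in 𝓝 p, ContDiffAt ℝ ∞ F q := (hF.eventually_mem hp).mono hF.smooth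
    rw [fderiv_gam_apply (hF.smooth p hp), fderiv_three_symm he, hF.fderiv_three_self hp,
      smul_zero]

theorem fderiv_christoffel (w : Coord n × Coord n) (a b : Coord n) :
    fderiv ℝ (fun q => christoffel F q a b) p w = fderiv ℝ (gam F) p w a b := by
  have e : (fun q => christoffel F q a b) =ᶠ[𝓝 p] fun q => gam F q a b := by
    filter_upwards [hF.eventually_mem hp] with q hq using christoffel_eq (hF.smooth q hq) a b
  rw [e.fderiv_eq, fderiv_clm_apply_two
    ((contDiffAt_gam (hF.smooth p hp)).differentiableAt (by simp))
    (differentiableAt_const _) (differentiableAt_const _)]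
  simp

theorem hhCurv_eq (a b c : Coord n) : hhCurv F p a b c = curv (gam F) p a b c := by
  simp only [hhCurv, horDeriv, curv_apply, hF.fderiv_christoffel hp, hF.nonlinConn_eq hp,
    christoffel_eq (hF.smooth p hp)]

theorem hvCurv_eq (v a b : Coord n) : hvCurv F p v a b = fderiv ℝ (gam F) p (0, v) a b :=
  hF.fderiv_christoffel hp _ _ _

theorem horCov_hhCurv_eq (w a b c : Coord n) :
    horCov F (hhCurv F) p w a b c = horCovC (gam F) (curv (gam F)) p w a b c := by
  have e : (fun q => hhCurv F q a b c) =ᶠ[𝓝 p] fun q => curv (gam F) q a b c := by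
    filter_upwards [hF.eventually_mem hp] with q hq using hF.hhCurv_eq hq a b c
  simp only [horCov, horCovC, horDeriv, hF.hhCurv_eq hp, christoffel_eq (hF.smooth p hp),
    hF.nonlinConn_eq hp]
  rw [e.fderiv_eq, fderiv_clm_apply_three
    ((contDiffAt_curv (contDiffAt_gam (hF.smooth p hp))).differentiableAt (by simp))
    (differentiableAt_const _) (differentiableAt_const _) (differentiableAt_const _)]
  simp

/-- P vanishes as soon as one of its last two arguments is y. With two copies of y the first
derivative vanishes too, since differentiating one copy leaves the other. -/
theorem fderiv_hvCurv_self (w : Coord n × Coord n) (v : Coord n) :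
    fderiv ℝ (fun q => hvCurv F q v p.2 p.2) p w = 0 := by
  have e : (fun q => hvCurv F q v p.2 p.2)
      =ᶠ[𝓝 p] fun q => fderiv ℝ (gam F) q (0, v) p.2 p.2 := by
    filter_upwards [hF.eventually_mem hp] with q hq using hF.hvCurv_eq hq v p.2 p.2
  rw [e.fderiv_eq, fderiv_clm_apply_three ((contDiffAt_fderiv (contDiffAt_gam
      (hF.smooth p hp))).differentiableAt (by simp))
    (differentiableAt_const _) (differentiableAt_const _) (differentiableAt_const _)]
  simp [hF.isBerwald.vert_self_fderiv hp, hF.isBerwald.vert_self' hp]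

theorem vertCov_hvCurv_self (v w : Coord n) : vertCov (hvCurv F) p w v p.2 p.2 = 0 :=
  hF.fderiv_hvCurv_self hp _ _

/-- Each correction term of the covariant derivative still has y in one of the last two slots of P.
-/
theorem horCov_hvCurv_self (v w : Coord n) : horCov F (hvCurv F) p w v p.2 p.2 = 0 := by
  simp only [horCov, horDeriv, hF.fderiv_hvCurv_self hp, hF.hvCurv_eq hp,
    hF.isBerwald.vert_self' hp, hF.isBerwald.vert_self _ hp, christoffel_eq (hF.smooth p hp)]
  simp

end IsSprayCoeff

end SprayCoefficients

/-! ### Partial derivatives of functions of two real variables -/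

section Surfaces

variable {E : Type*} [NormedAddCommGroup E] [NormedSpace ℝ E]

theorem deriv_slice_right {f : ℝ × ℝ → E} {a b : ℝ} (hf : DifferentiableAt ℝ f (a, b)) :
    deriv (fun s => f (a, s)) b = fderiv ℝ f (a, b) (0, 1) :=
  (hf.hasFDerivAt.comp_hasDerivAt b ((hasDerivAt_const b a).prodMk (hasDerivAt_id b))).deriv

theorem deriv_slice_left {f : ℝ × ℝ → E} {a b : ℝ} (hf : DifferentiableAt ℝ f (a, b)) :
    deriv (fun ε => f (ε, b)) a = fderiv ℝ f (a, b) (1, 0) :=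
  (hf.hasFDerivAt.comp_hasDerivAt a ((hasDerivAt_id a).prodMk (hasDerivAt_const a b))).deriv

theorem eventually_slice_right {P : ℝ × ℝ → Prop} {a b : ℝ} (h : ∀ᶠ z in 𝓝 (a, b), P z) :
    ∀ᶠ s in 𝓝 b, P (a, s) :=
  (Continuous.prodMk_right a).continuousAt.eventually h

theorem eventually_slice_left {P : ℝ × ℝ → Prop} {a b : ℝ} (h : ∀ᶠ z in 𝓝 (a, b), P z) :
    ∀ᶠ ε in 𝓝 a, P (ε, b) :=
  (Continuous.prodMk_left b).continuousAt.eventually h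

theorem deriv_deriv_slice_right {f : ℝ × ℝ → E} {a b : ℝ}
    (hf : ∀ᶠ z in 𝓝 (a, b), ContDiffAt ℝ ∞ f z) :
    deriv (deriv fun s => f (a, s)) b
      = fderiv ℝ (fun z => fderiv ℝ f z (0, 1)) (a, b) (0, 1) := by
  have e : deriv (fun s => f (a, s)) =ᶠ[𝓝 b] fun s => fderiv ℝ f (a, s) (0, 1) :=
    (eventually_slice_right hf).mono fun s hs =>
      deriv_slice_right (hs.differentiableAt (by simp))
  rw [e.deriv_eq, deriv_slice_right (f := fun z => fderiv ℝ f z (0, 1))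
    ((contDiffAt_fderiv_apply hf.self_of_nhds _).differentiableAt (by simp))]

theorem deriv_deriv_slice_left {f : ℝ × ℝ → E} {a b : ℝ}
    (hf : ∀ᶠ z in 𝓝 (a, b), ContDiffAt ℝ ∞ f z) :
    deriv (deriv fun ε => f (ε, b)) a
      = fderiv ℝ (fun z => fderiv ℝ f z (1, 0)) (a, b) (1, 0) := by
  have e : deriv (fun ε => f (ε, b)) =ᶠ[𝓝 a] fun ε => fderiv ℝ f (ε, b) (1, 0) :=
    (eventually_slice_left hf).mono fun s hs =>
      deriv_slice_left (hs.differentiableAt (by simp))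
  rw [e.deriv_eq, deriv_slice_left (f := fun z => fderiv ℝ f z (1, 0))
    ((contDiffAt_fderiv_apply hf.self_of_nhds _).differentiableAt (by simp))]

end Surfaces

/-! ### Deviation coefficients of a ribbon in a chart -/

section Ribbons

variable {n : ℕ}

/-- The map `(ε, s) ↦ x ε s`. -/
def surface (x : ℝ → ℝ → Coord n) (z : ℝ × ℝ) : Coord n := x z.1 z.2

/-- `x` is a ribbon in `U`, smooth on the open set `W` of parameters, with nonzero velocities and
with a geodesic as central curve. -/
structure IsRibbonOn (F : Coord n × Coord n → Coord n) (U : Set (Coord n)) (x : ℝ → ℝ → Coord n)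
    (W : Set (ℝ × ℝ)) : Prop where
  coeff : IsSprayCoeff F U
  isOpen : IsOpen W
  smooth : ∀ z ∈ W, ContDiffAt ℝ ∞ (surface x) z
  mem : ∀ z ∈ W, velLift (surface x) (0, 1) z ∈ slitOver U
  deriv_deriv_central : ∀ s, (0, s) ∈ W → deriv (deriv (x 0)) s = -F (x 0 s, deriv (x 0) s)

namespace IsRibbonOn

variable {F : Coord n × Coord n → Coord n} {U : Set (Coord n)} {x : ℝ → ℝ → Coord n}
  {W : Set (ℝ × ℝ)} (h : IsRibbonOn F U x W)
include h

theorem eventually_mem {z : ℝ × ℝ} (hz : z ∈ W) : ∀ᶠ w in 𝓝 z, w ∈ W := h.isOpen.mem_nhds hz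

theorem eventually_contDiffAt {z : ℝ × ℝ} (hz : z ∈ W) :
    ∀ᶠ w in 𝓝 z, ContDiffAt ℝ ∞ (surface x) w := (h.eventually_mem hz).mono h.smooth

theorem deriv_eq {ε s : ℝ} (hz : (ε, s) ∈ W) :
    deriv (x ε) s = fderiv ℝ (surface x) (ε, s) (0, 1) :=
  deriv_slice_right (f := surface x) ((h.smooth _ hz).differentiableAt (by simp))

theorem accel_eq {z : ℝ × ℝ} (hz : z ∈ W) : accel (gam F) (surface x) (0, 1) z
    = fderiv ℝ (fun z => fderiv ℝ (surface x) z (0, 1)) z (0, 1)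
      + F (velLift (surface x) (0, 1) z) := by
  rw [accel, covD, fderiv_velLift (h.smooth z hz)]
  exact congrArg _ (h.coeff.gam_self (h.mem z hz))

theorem accel_eq_deriv {ε s : ℝ} (hz : (ε, s) ∈ W) :
    accel (gam F) (surface x) (0, 1) (ε, s) = deriv (deriv (x ε)) s + F (x ε s, deriv (x ε) s) := by
  rw [h.accel_eq hz, ← deriv_deriv_slice_right (h.eventually_contDiffAt hz), h.deriv_eq hz]
  rfl

theorem geodesic (s : ℝ) (hs : (0, s) ∈ W) :
    accel (gam F) (surface x) (0, 1) (0, s) = 0 := by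
  rw [h.accel_eq_deriv hs, h.deriv_deriv_central s hs, neg_add_cancel]

variable {s : ℝ} (hs : (0, s) ∈ W)
include hs

theorem central_mem : central x s ∈ slitOver U := by
  rw [central, h.deriv_eq hs]; exact h.mem _ hs

theorem central_eq : central x s = velLift (surface x) (0, 1) (0, s) := by
  rw [central, h.deriv_eq hs]; rfl

theorem xiCoeff_one : xiCoeff x 1 s = fderiv ℝ (surface x) (0, s) (1, 0) := by
  rw [xiCoeff, iteratedDeriv_one]
  simp only [ribbonDiff]
  rw [deriv_sub_const]
  exact deriv_slice_left (f := surface x) ((h.smooth _ hs).differentiableAt (by simp))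

theorem xiCoeff_two : xiCoeff x 2 s
    = fderiv ℝ (fun z => fderiv ℝ (surface x) z (1, 0)) (0, s) (1, 0) := by
  rw [xiCoeff, iteratedDeriv_succ, iteratedDeriv_one, ←
    deriv_deriv_slice_left (h.eventually_contDiffAt hs)]
  congr 1
  ext1 ε
  simp only [ribbonDiff]
  rw [deriv_sub_const]
  rfl

/-- The deviation is a difference of two accelerations, because `Γ(y, y)` is the spray coefficient;
the one of the central geodesic is zero. -/
theorem exactDeviation_eq {ε : ℝ} (hz : (ε, s) ∈ W) :
    exactDeviation F x ε s = accel (gam F) (surface x) (0, 1) (ε, s) := by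
  have h1 : deriv (ribbonDiff x ε) =ᶠ[𝓝 s] fun s => deriv (x ε) s - deriv (x 0) s := by
    filter_upwards [eventually_slice_right (h.eventually_mem hz),
      eventually_slice_right (h.eventually_mem hs)] with t ht ht'
    exact deriv_fun_sub
      ((h.smooth _ ht).comp t (contDiffAt_const.prodMk contDiffAt_id)
        |>.differentiableAt (by simp))
      ((h.smooth _ ht').comp t (contDiffAt_const.prodMk contDiffAt_id)
        |>.differentiableAt (by simp))
  have hd (δ : ℝ) (hδ : (δ, s) ∈ W) : DifferentiableAt ℝ (deriv (x δ)) s := by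
    have e : deriv (x δ) =ᶠ[𝓝 s] fun t => fderiv ℝ (surface x) (δ, t) (0, 1) := by
      filter_upwards [eventually_slice_right (h.eventually_mem hδ)] with t ht using h.deriv_eq ht
    exact (((contDiffAt_fderiv_apply (h.smooth _ hδ) (0, 1)).comp s
      (contDiffAt_const.prodMk contDiffAt_id)).differentiableAt (by simp)).congr_of_eventuallyEq e
  have h2 : deriv (deriv (ribbonDiff x ε)) s = deriv (deriv (x ε)) s - deriv (deriv (x 0)) s := by
    rw [h1.deriv_eq, deriv_fun_sub (hd ε hz) (hd 0 hs)]
  have hg := h.geodesic s hs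
  rw [h.accel_eq_deriv hs] at hg
  have hm (δ : ℝ) (hδ : (δ, s) ∈ W) : (x δ s, deriv (x δ) s) ∈ slitOver U := by
    rw [h.deriv_eq hδ]; exact h.mem _ hδ
  have hF (δ : ℝ) (hδ : (δ, s) ∈ W) : christoffel F (x δ s, deriv (x δ) s) (deriv (x δ) s)
      (deriv (x δ) s) = F (x δ s, deriv (x δ) s) := by
    rw [christoffel_eq (h.coeff.smooth _ (hm δ hδ))]
    exact h.coeff.gam_self (hm δ hδ)
  rw [exactDeviation, h2, h1.eq_of_nhds, ribbonDiff, add_sub_cancel, add_sub_cancel, hF ε hz,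
    central, hF 0 hs, h.accel_eq_deriv hz, eq_neg_of_add_eq_zero_left hg]
  abel

theorem contDiffAt_accel : ContDiffAt ℝ ∞ (accel (gam F) (surface x) (0, 1)) (0, s) :=
  FinslerDeviation.contDiffAt_accel h.coeff.isBerwald (h.mem _ hs) (h.smooth _ hs)

theorem eventually_exactDeviation : (fun ε => exactDeviation F x ε s)
    =ᶠ[𝓝 0] fun ε => accel (gam F) (surface x) (0, 1) (ε, s) := by
  filter_upwards [eventually_slice_left (h.eventually_mem hs)] with ε hε
    using h.exactDeviation_eq hs hε

theorem devCoeff_one : devCoeff F x 1 s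
    = fderiv ℝ (accel (gam F) (surface x) (0, 1)) (0, s) (1, 0) := by
  rw [devCoeff, iteratedDeriv_one, (h.eventually_exactDeviation hs).deriv_eq,
    deriv_slice_left ((h.contDiffAt_accel hs).differentiableAt (by simp))]
  simp

theorem devCoeff_two : (2 : ℝ) • devCoeff F x 2 s
    = fderiv ℝ (fderiv ℝ (accel (gam F) (surface x) (0, 1))) (0, s) (1, 0) (1, 0) := by
  have he : ∀ᶠ z in 𝓝 ((0 : ℝ), s), ContDiffAt ℝ ∞ (accel (gam F) (surface x) (0, 1)) z :=
    (h.eventually_mem hs).mono fun z hz =>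
      FinslerDeviation.contDiffAt_accel h.coeff.isBerwald (h.mem _ hz) (h.smooth _ hz)
  rw [devCoeff, iteratedDeriv_succ, iteratedDeriv_one,
    (h.eventually_exactDeviation hs).deriv.deriv_eq, deriv_deriv_slice_left he,
    fderiv_fderiv_apply he.self_of_nhds, smul_smul]
  simp

/-- The covariant derivative along the central curve as a covariant derivative on the surface. -/
theorem covAlong_eq {V : ℝ → Coord n} {V' : ℝ × ℝ → Coord n}
    (hV : V =ᶠ[𝓝 s] fun s => V' (0, s)) (hV' : DifferentiableAt ℝ V' (0, s)) :
    covAlong F x V s = covD (gam F) (velLift (surface x) (0, 1)) (0, 1) V' (0, s) := by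
  rw [covAlong, covD, hV.deriv_eq, deriv_slice_right hV', h.deriv_eq hs, hV.eq_of_nhds,
    h.central_eq hs, christoffel_eq (h.coeff.smooth _ (h.mem _ hs)),
    fderiv_velLift (h.smooth _ hs)]

theorem jacobiOp_eq {V : ℝ → Coord n} {V' : ℝ × ℝ → Coord n}
    (hV : ∀ s, (0, s) ∈ W → V s = V' (0, s)) (hV' : ∀ z ∈ W, ContDiffAt ℝ ∞ V' z) :
    jacobiOp F x V s
      = covD (gam F) (velLift (surface x) (0, 1)) (0, 1)
          (covD (gam F) (velLift (surface x) (0, 1)) (0, 1) V') (0, s)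
        + curv (gam F) (velLift (surface x) (0, 1) (0, s)) (V' (0, s))
            (fderiv ℝ (surface x) (0, s) (0, 1)) (fderiv ℝ (surface x) (0, s) (0, 1)) := by
  have hV₁ (t : ℝ) (ht : (0, t) ∈ W) : V =ᶠ[𝓝 t] fun s => V' (0, s) := by
    filter_upwards [eventually_slice_right (h.eventually_mem ht)] with r hr using hV r hr
  have e : covAlong F x V =ᶠ[𝓝 s]
      fun s => covD (gam F) (velLift (surface x) (0, 1)) (0, 1) V' (0, s) := by
    filter_upwards [eventually_slice_right (h.eventually_mem hs)] with r hr
      using h.covAlong_eq hr (hV₁ r hr) ((hV' _ hr).differentiableAt (by simp))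
  rw [jacobiOp, h.covAlong_eq hs e ((contDiffAt_covD
      (h.coeff.isBerwald.smooth _ (h.mem _ hs)) (contDiffAt_velLift (h.smooth _ hs))
      (hV' _ hs) _).differentiableAt (by simp)),
    h.coeff.hhCurv_eq (h.central_mem hs), h.central_eq hs, h.deriv_eq hs, hV s hs]

/-- The first order deviation equation is the Jacobi equation. -/
theorem devCoeff_one_eq_jacobiOp : devCoeff F x 1 s = jacobiOp F x (xiCoeff x 1) s := by
  have hc := covD_accel h.coeff.isBerwald h.isOpen h.smooth h.mem (1, 0) hs
  -- As the acceleration vanishes at the point, its covariant ε-derivative is the ordinary one.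
  rw [h.jacobiOp_eq hs (V' := fun z => fderiv ℝ (surface x) z (1, 0))
    (fun r hr => h.xiCoeff_one hr) (fun z hz => contDiffAt_fderiv_apply (h.smooth z hz) _), ← hc,
    covD, h.geodesic s hs, map_zero, add_zero, h.devCoeff_one hs]

theorem jTwo_eq : jTwo F x s = covD (gam F) (velLift (surface x) (0, 1)) (1, 0)
    (fun z => fderiv ℝ (surface x) z (1, 0)) (0, s) := by
  rw [jTwo, covD, h.xiCoeff_two hs, h.xiCoeff_one hs, h.central_eq hs,
    christoffel_eq (h.coeff.smooth _ (h.mem _ hs)), fderiv_velLift (h.smooth _ hs)]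

/-- The second order deviation equation is the covariant equation for `J₂`. -/
theorem devCoeff_two_eq (h1 : devCoeff F x 1 s = 0) : (2 : ℝ) • devCoeff F x 2 s
    = jacobiOp F x (jTwo F x) s - secondOrderRHS F x s := by
  have hξ (z : ℝ × ℝ) (hz : z ∈ W) :=
    contDiffAt_fderiv_apply (h.smooth z hz) ((1 : ℝ), (0 : ℝ))
  -- The acceleration vanishes along the central curve, not only at s.
  have ht : fderiv ℝ (accel (gam F) (surface x) (0, 1)) (0, s) (0, 1) = 0 := by
    rw [← deriv_slice_right ((h.contDiffAt_accel hs).differentiableAt (by simp))]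
    have e : (fun s => accel (gam F) (surface x) (0, 1) (0, s)) =ᶠ[𝓝 s] fun _ => 0 := by
      filter_upwards [eventually_slice_right (h.eventually_mem hs)] with r hr
        using h.geodesic r hr
    rw [e.deriv_eq, deriv_const]
  rw [h.devCoeff_one hs] at h1
  have hD : covAlong F x (xiCoeff x 1) s = covD (gam F) (velLift (surface x) (0, 1)) (0, 1)
      (fun z => fderiv ℝ (surface x) z (1, 0)) (0, s) := by
    refine h.covAlong_eq hs ?_ ((hξ _ hs).differentiableAt (by simp))
    filter_upwards [eventually_slice_right (h.eventually_mem hs)] with r hr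
      using h.xiCoeff_one hr
  have hP (v w : Coord n) := h.coeff.vertCov_hvCurv_self (h.central_mem hs) v w
  have hP' (v w : Coord n) := h.coeff.horCov_hvCurv_self (h.central_mem hs) v w
  have e2 : (central x s).2 = deriv (x 0) s := rfl
  rw [e2] at hP hP'
  rw [h.devCoeff_two hs, fderiv_fderiv_accel h.coeff.isBerwald h.isOpen h.smooth h.mem (1, 0) hs
    (h.geodesic s hs) ht h1, h.jacobiOp_eq hs (fun r hr => h.jTwo_eq hr) (fun z hz =>
      contDiffAt_covD (h.coeff.isBerwald.smooth _ (h.mem _ hz)) (contDiffAt_velLift (h.smooth z hz))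
        (hξ z hz) _)]
  simp only [secondOrderRHS]
  rw [hP, hP', h.coeff.horCov_hhCurv_eq (h.central_mem hs),
    h.coeff.horCov_hhCurv_eq (h.central_mem hs), h.coeff.hhCurv_eq (h.central_mem hs), hD,
    h.central_eq hs, h.deriv_eq hs, h.xiCoeff_one hs, smul_zero, sub_zero, sub_zero]

/-- Both deviation equations hold for a variation through geodesics. -/
theorem devCoeff_eq_zero (hg : ∀ ε s, (ε, s) ∈ W →
    deriv (deriv (x ε)) s = -F (x ε s, deriv (x ε) s)) :
    devCoeff F x 1 s = 0 ∧ devCoeff F x 2 s = 0 := by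
  have e : accel (gam F) (surface x) (0, 1) =ᶠ[𝓝 (0, s)] fun _ => 0 :=
    (h.eventually_mem hs).mono fun z hz => by
      rw [h.accel_eq_deriv (ε := z.1) (s := z.2) hz, hg _ _ hz, neg_add_cancel]
  have h1 := h.devCoeff_one hs
  have h2 := h.devCoeff_two hs
  rw [e.fderiv_eq] at h1
  rw [e.fderiv.fderiv_eq] at h2
  simp at h1 h2
  exact ⟨h1, by simpa using h2⟩

end IsRibbonOn

end Ribbons

/-! ### Covariance under a change of coordinates -/

section ChangeOfChart

variable {n : ℕ}

/-- Under the change of coordinates `χ` the spray coefficients `F` over `U` are transformed into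
the spray coefficients `F'` over `U'`. -/
structure IsSprayTransition (F : Coord n × Coord n → Coord n) (U : Set (Coord n))
    (F' : Coord n × Coord n → Coord n) (U' : Set (Coord n)) (χ : Coord n → Coord n) : Prop where
  coeff : IsSprayCoeff F U
  coeff' : IsSprayCoeff F' U'
  smooth : ∀ x ∈ U, ContDiffAt ℝ ∞ χ x
  mapsTo : ∀ p ∈ slitOver U, (χ p.1, fderiv ℝ χ p.1 p.2) ∈ slitOver U'
  law : ∀ p ∈ slitOver U, F' (χ p.1, fderiv ℝ χ p.1 p.2)
    = fderiv ℝ χ p.1 (F p) - fderiv ℝ (fderiv ℝ χ) p.1 p.2 p.2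

theorem fderiv_fibre {G : Coord n × Coord n → Coord n} {x y : Coord n}
    {T : Coord n →L[ℝ] Coord n} (hG : DifferentiableAt ℝ G (x, T y)) (v : Coord n) :
    fderiv ℝ (fun y => G (x, T y)) y v = fderiv ℝ G (x, T y) (0, T v) := by
  have hc : HasFDerivAt (fun y => (x, T y)) ((0 : Coord n →L[ℝ] Coord n).prod T) y :=
    (hasFDerivAt_const x y).prodMk T.hasFDerivAt
  rw [fderiv_comp_apply (c := fun y => (x, T y)) hG hc.differentiableAt, hc.fderiv]
  rfl

/-- The second derivative along a fibre. -/
theorem fderiv_fderiv_fibre {G : Coord n × Coord n → Coord n} {x y : Coord n}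
    {T : Coord n →L[ℝ] Coord n} (hG : ∀ᶠ q in 𝓝 (x, T y), ContDiffAt ℝ ∞ G q) (v w : Coord n) :
    fderiv ℝ (fun y => fderiv ℝ (fun y => G (x, T y)) y v) y w
      = (2 : ℝ) • gam G (x, T y) (T v) (T w) := by
  have hc : ContinuousAt (fun y => (x, T y)) y := by fun_prop
  have e : (fun y => fderiv ℝ (fun y => G (x, T y)) y v)
      =ᶠ[𝓝 y] fun y => fderiv ℝ G (x, T y) (0, T v) := by
    filter_upwards [hc.eventually hG] with z hz
      using fderiv_fibre (hz.differentiableAt (by simp)) v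
  rw [e.fderiv_eq, fderiv_fibre (G := fun q => fderiv ℝ G q (0, T v))
    ((contDiffAt_fderiv_apply hG.self_of_nhds _).differentiableAt (by simp)),
    fderiv_fderiv_apply hG.self_of_nhds, gam_apply, smul_smul]
  simp

namespace IsSprayTransition

variable {F F' : Coord n × Coord n → Coord n} {U U' : Set (Coord n)} {χ : Coord n → Coord n}
  (h : IsSprayTransition F U F' U' χ)
include h

/-- The transformation law of the connection coefficients. -/
theorem gam_law {p : Coord n × Coord n} (hp : p ∈ slitOver U) (a b : Coord n) :
    gam F' (χ p.1, fderiv ℝ χ p.1 p.2) (fderiv ℝ χ p.1 a) (fderiv ℝ χ p.1 b)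
      = fderiv ℝ χ p.1 (gam F p a b) - fderiv ℝ (fderiv ℝ χ) p.1 a b := by
  obtain ⟨x, y⟩ := p
  set A := fderiv ℝ χ x with hA
  set B := fderiv ℝ (fderiv ℝ χ) x with hB
  have hs (v w : Coord n) : B v w = B w v := fderiv_fderiv_symm (h.smooth x hp.1) v w
  have hy : ∀ᶠ z in 𝓝 y, (x, z) ∈ slitOver U :=
    (Continuous.prodMk_right x).continuousAt.eventually (h.coeff.eventually_mem hp)
  -- A named identity lets `fderiv_fderiv_fibre` apply to F as it does to F' with the linear map A.
  let T : Coord n →L[ℝ] Coord n := ContinuousLinearMap.id ℝ (Coord n)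
  have hF (z : Coord n) (hz : (x, z) ∈ slitOver U) : ContDiffAt ℝ ∞ (fun z => F (x, T z)) z :=
    (h.coeff.smooth _ hz).comp z (contDiffAt_const.prodMk contDiffAt_id)
  have e : (fun z => F' (χ x, A z)) =ᶠ[𝓝 y] fun z => A (F (x, T z)) - B z z :=
    hy.mono fun z hz => h.law _ hz
  have e1 : (fun z => fderiv ℝ (fun z => A (F (x, T z)) - B z z) z a)
      =ᶠ[𝓝 y] fun z => A (fderiv ℝ (fun z => F (x, T z)) z a) - (B a z + B z a) := by
    filter_upwards [hy] with z hz
    have hd := (hF z hz).differentiableAt (by simp)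
    rw [fderiv_fun_sub ((differentiableAt_const A).clm_apply hd)
      (B.differentiableAt.clm_apply (differentiableAt_fun_id)), sub_apply,
      fderiv_clm_apply_one (differentiableAt_const A) hd,
      fderiv_clm_apply_one B.differentiableAt differentiableAt_fun_id]
    simp
  -- The law of Γ is half the second fibre derivative of the law of the spray; the quadratic form B
  -- contributes its polarization.
  have e2 : fderiv ℝ (fun z => fderiv ℝ (fun z => A (F (x, T z)) - B z z) z a) y b
      = A ((2 : ℝ) • gam F (x, y) a b) - (B a b + B b a) := by
    have hd := (contDiffAt_fderiv_apply (hF y hp) a).differentiableAt (by simp)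
    have hBa : DifferentiableAt ℝ (fun z => B z a) y :=
      B.differentiableAt.clm_apply (differentiableAt_const a)
    rw [e1.fderiv_eq, fderiv_fun_sub ((differentiableAt_const A).clm_apply hd)
      ((B a).differentiableAt.fun_add hBa), sub_apply,
      fderiv_clm_apply_one (differentiableAt_const A) hd,
      fderiv_fun_add (B a).differentiableAt hBa, add_apply,
      fderiv_clm_apply_one B.differentiableAt (differentiableAt_const a),
      fderiv_fderiv_fibre ((h.coeff.eventually_mem hp).mono h.coeff.smooth)]
    simp [T]
  have e3 : (fun z => fderiv ℝ (fun z => F' (χ x, A z)) z a) =ᶠ[𝓝 y]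
      fun z => fderiv ℝ (fun z => A (F (x, T z)) - B z z) z a :=
    (e.fderiv (𝕜 := ℝ)).mono fun z hz => congrArg (fun f : Coord n →L[ℝ] Coord n => f a) hz
  have e4 := congrArg (fun f : Coord n →L[ℝ] Coord n => f b) e3.fderiv_eq
  rw [e2, fderiv_fderiv_fibre ((h.coeff'.eventually_mem (h.mapsTo _ hp)).mono h.coeff'.smooth),
    hs b a, map_smul, ← two_smul ℝ (B a b), ← smul_sub] at e4
  exact smul_right_injective _ (two_ne_zero (α := ℝ)) e4

variable {x x' : ℝ → ℝ → Coord n} {W : Set (ℝ × ℝ)} (hx : IsRibbonOn F U x W)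
  (hx' : IsRibbonOn F' U' x' W) (hχ : ∀ z ∈ W, surface x' z = χ (surface x z))
include hx hx' hχ

omit hx' in
theorem fderiv_surface {z : ℝ × ℝ} (hz : z ∈ W) (v : ℝ × ℝ) :
    fderiv ℝ (surface x') z v = fderiv ℝ χ (surface x z) (fderiv ℝ (surface x) z v) := by
  have e : surface x' =ᶠ[𝓝 z] fun z => χ (surface x z) := (hx.eventually_mem hz).mono hχ
  rw [e.fderiv_eq, fderiv_comp_apply (c := surface x)
    ((h.smooth _ (hx.mem z hz).1).differentiableAt (by simp))
    ((hx.smooth z hz).differentiableAt (by simp))]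

omit hx' hχ in
theorem fderiv_fderiv_chart {V : ℝ × ℝ → Coord n} {z : ℝ × ℝ} (hz : z ∈ W)
    (hV : DifferentiableAt ℝ V z) (v : ℝ × ℝ) :
    fderiv ℝ (fun z => fderiv ℝ χ (surface x z) (V z)) z v
      = fderiv ℝ (fderiv ℝ χ) (surface x z) (fderiv ℝ (surface x) z v) (V z)
        + fderiv ℝ χ (surface x z) (fderiv ℝ V z v) := by
  have hc : ContDiffAt ℝ ∞ (fderiv ℝ χ) (surface x z) :=
    contDiffAt_fderiv (h.smooth _ (hx.mem z hz).1)
  have hd := (hx.smooth z hz).differentiableAt (by simp)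
  rw [fderiv_clm_apply_one (g := fun z => fderiv ℝ χ (surface x z))
    ((hc.differentiableAt (by simp)).comp z hd) hV,
    fderiv_comp_apply (hc.differentiableAt (by simp)) hd]

omit hx' in
theorem fderiv_fderiv_surface {z : ℝ × ℝ} (hz : z ∈ W) (v w : ℝ × ℝ) :
    fderiv ℝ (fun z => fderiv ℝ (surface x') z v) z w
      = fderiv ℝ (fderiv ℝ χ) (surface x z) (fderiv ℝ (surface x) z w) (fderiv ℝ (surface x) z v)
        + fderiv ℝ χ (surface x z) (fderiv ℝ (fun z => fderiv ℝ (surface x) z v) z w) := by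
  have e : (fun z => fderiv ℝ (surface x') z v) =ᶠ[𝓝 z]
      fun z => fderiv ℝ χ (surface x z) (fderiv ℝ (surface x) z v) :=
    (hx.eventually_mem hz).mono fun w hw => h.fderiv_surface hx hχ hw v
  rw [e.fderiv_eq, h.fderiv_fderiv_chart hx hz
    ((contDiffAt_fderiv_apply (hx.smooth z hz) v).differentiableAt (by simp))]

omit hx' in
theorem velLift_surface {z : ℝ × ℝ} (hz : z ∈ W) : velLift (surface x') (0, 1) z
    = (χ (velLift (surface x) (0, 1) z).1, fderiv ℝ χ (velLift (surface x) (0, 1) z).1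
        (velLift (surface x) (0, 1) z).2) := by
  rw [velLift, hχ z hz, h.fderiv_surface hx hχ hz]; rfl

/-- The acceleration is transformed as a vector. -/
theorem accel_law {z : ℝ × ℝ} (hz : z ∈ W) : accel (gam F') (surface x') (0, 1) z
    = fderiv ℝ χ (surface x z) (accel (gam F) (surface x) (0, 1) z) := by
  rw [hx'.accel_eq hz, hx.accel_eq hz, h.velLift_surface hx hχ hz, h.law _ (hx.mem z hz),
    h.fderiv_fderiv_surface hx hχ hz, map_add]
  simp only [velLift]
  abel

variable {s : ℝ} (hs : (0, s) ∈ W)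
include hs

theorem xiCoeff_one_law : xiCoeff x' 1 s = fderiv ℝ χ (x 0 s) (xiCoeff x 1 s) := by
  rw [hx'.xiCoeff_one hs, hx.xiCoeff_one hs, h.fderiv_surface hx hχ hs]; rfl

/-- The term D²χ(Ξ₁, Ξ₁) acquired by Ξ₂ is cancelled by the inhomogeneous term of Γ. -/
theorem jTwo_law : jTwo F' x' s = fderiv ℝ χ (x 0 s) (jTwo F x s) := by
  have hg := h.gam_law (hx.mem _ hs) (fderiv ℝ (surface x) (0, s) (1, 0))
    (fderiv ℝ (surface x) (0, s) (1, 0))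
  rw [← h.velLift_surface hx hχ hs] at hg
  rw [hx'.jTwo_eq hs, hx.jTwo_eq hs, covD, covD, fderiv_velLift (hx.smooth _ hs),
    fderiv_velLift (hx'.smooth _ hs), h.fderiv_fderiv_surface hx hχ hs,
    h.fderiv_surface hx hχ hs]
  simp only [velLift] at hg ⊢
  rw [hg, map_add]
  simp only [surface]
  abel

omit hs in
theorem fderiv_accel_law {z : ℝ × ℝ} (hz : z ∈ W) (v : ℝ × ℝ) :
    fderiv ℝ (accel (gam F') (surface x') (0, 1)) z v
      = fderiv ℝ (fderiv ℝ χ) (surface x z) (fderiv ℝ (surface x) z v)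
          (accel (gam F) (surface x) (0, 1) z)
        + fderiv ℝ χ (surface x z) (fderiv ℝ (accel (gam F) (surface x) (0, 1)) z v) := by
  have e : accel (gam F') (surface x') (0, 1) =ᶠ[𝓝 z]
      fun z => fderiv ℝ χ (surface x z) (accel (gam F) (surface x) (0, 1) z) :=
    (hx.eventually_mem hz).mono fun w hw => h.accel_law hx hx' hχ hw
  rw [e.fderiv_eq, h.fderiv_fderiv_chart hx hz ((contDiffAt_accel h.coeff.isBerwald (hx.mem z hz)
    (hx.smooth z hz)).differentiableAt (by simp))]

/-- The D²χ term multiplies the acceleration, which is zero on the central curve. -/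
theorem devCoeff_one_law : devCoeff F' x' 1 s = fderiv ℝ χ (x 0 s) (devCoeff F x 1 s) := by
  rw [hx'.devCoeff_one hs, hx.devCoeff_one hs, h.fderiv_accel_law hx hx' hχ hs,
    hx.geodesic s hs, map_zero, zero_add]
  rfl

/-- Every term with a second or third derivative of χ carries a factor A or ∂_ε A; the vanishing of
the latter is the first order equation. -/
theorem devCoeff_two_law (h1 : devCoeff F x 1 s = 0) :
    (2 : ℝ) • devCoeff F' x' 2 s = fderiv ℝ χ (x 0 s) ((2 : ℝ) • devCoeff F x 2 s) := by
  have hA {z : ℝ × ℝ} (hz : z ∈ W) : ContDiffAt ℝ ∞ (accel (gam F) (surface x) (0, 1)) z :=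
    contDiffAt_accel h.coeff.isBerwald (hx.mem z hz) (hx.smooth z hz)
  have hA' : ContDiffAt ℝ ∞ (accel (gam F') (surface x') (0, 1)) (0, s) :=
    hx'.contDiffAt_accel hs
  rw [hx.devCoeff_one hs] at h1
  have e : (fun z => fderiv ℝ (accel (gam F') (surface x') (0, 1)) z (1, 0)) =ᶠ[𝓝 (0, s)]
      fun z => fderiv ℝ (fderiv ℝ χ) (surface x z) (fderiv ℝ (surface x) z (1, 0))
          (accel (gam F) (surface x) (0, 1) z)
        + fderiv ℝ χ (surface x z) (fderiv ℝ (accel (gam F) (surface x) (0, 1)) z (1, 0)) :=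
    (hx.eventually_mem hs).mono fun z hz => h.fderiv_accel_law hx hx' hχ hz _
  have hχ3 : ContDiffAt ℝ ∞ (fun z => fderiv ℝ (fderiv ℝ χ) (surface x z)) (0, s) :=
    (contDiffAt_fderiv (contDiffAt_fderiv (h.smooth _ (hx.mem _ hs).1))).comp (0, s)
      (hx.smooth _ hs)
  have hχ2 : ContDiffAt ℝ ∞ (fun z => fderiv ℝ χ (surface x z)) (0, s) :=
    (contDiffAt_fderiv (h.smooth _ (hx.mem _ hs).1)).comp (0, s) (hx.smooth _ hs)
  have hξ := contDiffAt_fderiv_apply (hx.smooth _ hs) ((1 : ℝ), (0 : ℝ))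
  have hA1 := contDiffAt_fderiv_apply (hA hs) ((1 : ℝ), (0 : ℝ))
  rw [hx'.devCoeff_two hs, hx.devCoeff_two hs, ← fderiv_fderiv_apply hA', e.fderiv_eq,
    fderiv_fun_add (((hχ3.clm_apply hξ).clm_apply (hA hs)).differentiableAt (by simp))
      ((hχ2.clm_apply hA1).differentiableAt (by simp)), add_apply,
    fderiv_clm_apply_two (hχ3.differentiableAt (by simp)) (hξ.differentiableAt (by simp))
      ((hA hs).differentiableAt (by simp)),
    h.fderiv_fderiv_chart hx hs (hA1.differentiableAt (by simp)), fderiv_fderiv_apply (hA hs), h1,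
    hx.geodesic s hs]
  simp [surface]

end IsSprayTransition

end ChangeOfChart

/-! ### Induced charts of the tangent bundle and components of a spray -/

section Charts

variable {n : ℕ} {M : Type*} [TopologicalSpace M] [ChartedSpace (Coord n) M]

theorem mdifferentiable_chart {φ : OpenPartialHomeomorph M (Coord n)}
    (hφ : φ ∈ IsManifold.maximalAtlas 𝓘(ℝ, Coord n) ∞ M) :
    φ.MDifferentiable 𝓘(ℝ, Coord n) 𝓘(ℝ, Coord n) :=
  ⟨(contMDiffOn_of_mem_maximalAtlas hφ).mdifferentiableOn (by simp),
    (contMDiffOn_symm_of_mem_maximalAtlas hφ).mdifferentiableOn (by simp)⟩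

variable {φ : OpenPartialHomeomorph M (Coord n)}
  (hφ : φ ∈ IsManifold.maximalAtlas 𝓘(ℝ, Coord n) ∞ M)
include hφ

theorem ofCoord_toCoord {u : TangentBundle 𝓘(ℝ, Coord n) M} (hu : u.1 ∈ φ.source) :
    ofCoord φ (toCoord φ u) = u := by
  obtain ⟨x, v⟩ := u
  have h := (mdifferentiable_chart hφ).symm_comp_deriv hu
  refine Bundle.TotalSpace.ext (φ.left_inv hu) (heq_of_eq ?_)
  exact congrArg (fun f : Coord n →L[ℝ] Coord n => f v) h

theorem toCoord_ofCoord {p : Coord n × Coord n} (hp : p.1 ∈ φ.target) :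
    toCoord φ (ofCoord φ p) = p := by
  obtain ⟨x, v⟩ := p
  have h := (mdifferentiable_chart hφ).comp_symm_deriv hp
  exact Prod.ext (φ.right_inv hp) (congrArg (fun f : Coord n →L[ℝ] Coord n => f v) h)

theorem toCoord_snd_ne_zero {u : TangentBundle 𝓘(ℝ, Coord n) M} (hu : u.1 ∈ φ.source)
    (hu' : u ∈ slit n M) : (toCoord φ u).2 ≠ 0 := by
  intro h0
  exact hu' ((mdifferentiable_chart hφ).mfderiv_injective hu (h0.trans (map_zero _).symm))

theorem toCoord_mem {u : TangentBundle 𝓘(ℝ, Coord n) M} (hu : u.1 ∈ φ.source)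
    (hu' : u ∈ slit n M) : toCoord φ u ∈ slitOver φ.target :=
  ⟨φ.map_source hu, toCoord_snd_ne_zero hφ hu hu'⟩

theorem ofCoord_mem_slit {p : Coord n × Coord n} (hp : p ∈ slitOver φ.target) :
    ofCoord φ p ∈ slit n M := by
  intro h0
  have h := toCoord_ofCoord hφ hp.1
  apply hp.2
  rw [← h]
  exact (congrArg _ h0).trans (map_zero (mfderiv 𝓘(ℝ, Coord n) 𝓘(ℝ, Coord n) φ (φ.symm p.1)))

omit hφ in
theorem contMDiffOn_tangentMap {H E H' E' : Type*} [NormedAddCommGroup E] [NormedSpace ℝ E]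
    [TopologicalSpace H] {I : ModelWithCorners ℝ E H} {N : Type*} [TopologicalSpace N]
    [ChartedSpace H N] [IsManifold I 1 N] [NormedAddCommGroup E'] [NormedSpace ℝ E']
    [TopologicalSpace H'] {I' : ModelWithCorners ℝ E' H'} {N' : Type*} [TopologicalSpace N']
    [ChartedSpace H' N'] [IsManifold I' 1 N'] {f : N → N'} {s : Set N} (hs : IsOpen s)
    (hf : ContMDiffOn I I' ∞ f s) :
    ContMDiffOn I.tangent I'.tangent ∞ (tangentMap I I' f)
      (Bundle.TotalSpace.proj ⁻¹' s : Set (TangentBundle I N)) :=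
  (hf.contMDiffOn_tangentMapWithin (m := ∞) (by simp) hs.uniqueMDiffOn).congr fun p hp => by
    rw [tangentMapWithin, tangentMap, mfderivWithin_of_isOpen hs hp]

variable [IsManifold 𝓘(ℝ, Coord n) ∞ M]

theorem contMDiffOn_toCoord :
    ContMDiffOn 𝓘(ℝ, Coord n).tangent 𝓘(ℝ, Coord n × Coord n) ∞ (toCoord φ)
      (Bundle.TotalSpace.proj ⁻¹' φ.source) := by
  have h := contMDiffOn_tangentMap φ.open_source (contMDiffOn_of_mem_maximalAtlas hφ)
  exact ((Bundle.contMDiff_proj (TangentSpace 𝓘(ℝ, Coord n))).comp_contMDiffOn h).prodMk_space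
    ((contMDiff_snd_tangentBundle_modelSpace (Coord n) 𝓘(ℝ, Coord n)).comp_contMDiffOn h)

theorem contMDiffOn_ofCoord :
    ContMDiffOn 𝓘(ℝ, Coord n × Coord n) 𝓘(ℝ, Coord n).tangent ∞ (ofCoord φ)
      {p | p.1 ∈ φ.target} := by
  have h := contMDiffOn_tangentMap φ.open_target (contMDiffOn_symm_of_mem_maximalAtlas hφ)
  have h' : ContMDiff 𝓘(ℝ, Coord n × Coord n) 𝓘(ℝ, Coord n).tangent ∞
      (fun p : Coord n × Coord n => (⟨p.1, p.2⟩ : TangentBundle 𝓘(ℝ, Coord n) (Coord n))) := by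
    intro p
    refine Bundle.contMDiffAt_totalSpace.2 ⟨contDiff_fst.contMDiff.contMDiffAt, ?_⟩
    convert! (contDiff_snd.contMDiff (n := ∞)).contMDiffAt (x := p) with q
    simp
    rfl
  exact h.comp h'.contMDiffOn fun p hp => hp

theorem mdifferentiableAt_toCoord {u : TangentBundle 𝓘(ℝ, Coord n) M} (hu : u.1 ∈ φ.source) :
    MDifferentiableAt 𝓘(ℝ, Coord n).tangent 𝓘(ℝ, Coord n × Coord n) (toCoord φ) u :=
  ((contMDiffOn_toCoord hφ).contMDiffAt ((φ.open_source.preimage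
    (FiberBundle.continuous_proj (Coord n) (TangentSpace 𝓘(ℝ, Coord n)))).mem_nhds hu)
    ).mdifferentiableAt (by simp)

omit hφ in
/-- The components of a vector field on `TM` in the chart induced by `φ`. -/
def fieldCoord (S : FieldOnTangent n M) (φ : OpenPartialHomeomorph M (Coord n))
    (u : TangentBundle 𝓘(ℝ, Coord n) M) : Coord n × Coord n :=
  mfderiv 𝓘(ℝ, Coord n).tangent 𝓘(ℝ, Coord n × Coord n) (toCoord φ) u (S u)

variable {S : FieldOnTangent n M}

theorem sprayCoeff_toCoord {u : TangentBundle 𝓘(ℝ, Coord n) M} (hu : u.1 ∈ φ.source) :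
    sprayCoeff S φ (toCoord φ u) = -(fieldCoord S φ u).2 := by
  change -(fieldCoord S φ (ofCoord φ (toCoord φ u))).2 = _
  rw [ofCoord_toCoord hφ hu]

theorem isSprayCoeff (hS : IsSpray S) : IsSprayCoeff (sprayCoeff S φ) φ.target where
  isOpen := φ.open_target
  smooth p hp := by
    have ho : IsOpen (Bundle.TotalSpace.proj ⁻¹' φ.source :
        Set (TangentBundle 𝓘(ℝ, Coord n) M)) :=
      φ.open_source.preimage (FiberBundle.continuous_proj (Coord n) (TangentSpace 𝓘(ℝ, Coord n)))
    -- The components of S are the fibre part of the tangent map of `toCoord φ` composed with S,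
    -- hence smooth.
    have h1 := (contMDiff_snd_tangentBundle_modelSpace (n := ∞) (Coord n × Coord n)
      𝓘(ℝ, Coord n × Coord n)).comp_contMDiffOn
        (contMDiffOn_tangentMap ho (contMDiffOn_toCoord hφ))
    have h2 : ContMDiffOn 𝓘(ℝ, Coord n × Coord n) 𝓘(ℝ, Coord n × Coord n) ∞
        (fun p => fieldCoord S φ (ofCoord φ p)) (slitOver φ.target) :=
      h1.comp (hS.smooth.comp ((contMDiffOn_ofCoord hφ).mono fun p hp => hp.1)
        fun p hp => ofCoord_mem_slit hφ hp) fun p hp => φ.map_target hp.1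
    have hop : IsOpen (slitOver φ.target) := (φ.open_target.preimage continuous_fst).inter
      (isOpen_compl_singleton.preimage continuous_snd)
    exact ((contMDiffOn_iff_contDiffOn.1 h2).contDiffAt (hop.mem_nhds hp)).snd.neg
  homogeneous p hp k hk := hS.homogeneous φ hφ p.1 hp.1 p.2 hp.2 k hk

/-- The first component of `toCoord φ` is φ after the projection; the chain rule and the semispray
condition give the value. -/
theorem fieldCoord_fst (hS : IsSpray S) {u : TangentBundle 𝓘(ℝ, Coord n) M}
    (hu : u.1 ∈ φ.source) (hu' : u ∈ slit n M) :
    (fieldCoord S φ u).1 = (toCoord φ u).2 := by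
  have h1 : HasMFDerivAt 𝓘(ℝ, Coord n).tangent 𝓘(ℝ, Coord n) (fun w => (toCoord φ w).1) u
      ((ContinuousLinearMap.fst ℝ (Coord n) (Coord n)).comp
        (mfderiv 𝓘(ℝ, Coord n).tangent 𝓘(ℝ, Coord n × Coord n) (toCoord φ) u)) :=
    (ContinuousLinearMap.fst ℝ (Coord n) (Coord n)).hasMFDerivAt.comp u
      (mdifferentiableAt_toCoord hφ hu).hasMFDerivAt
  have hπ : MDifferentiableAt 𝓘(ℝ, Coord n).tangent 𝓘(ℝ, Coord n)
      (fun w : TangentBundle 𝓘(ℝ, Coord n) M => w.1) u :=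
    (Bundle.contMDiff_proj (n := 1) (TangentSpace 𝓘(ℝ, Coord n))).contMDiffAt.mdifferentiableAt
      (by simp)
  have h2 := ((mdifferentiable_chart hφ).mdifferentiableAt hu).hasMFDerivAt.comp u
    hπ.hasMFDerivAt
  have h3 := hasMFDerivAt_unique h1 h2
  have h4 := congrArg (fun f : (TangentSpace 𝓘(ℝ, Coord n).tangent u) →L[ℝ] Coord n => f (S u)) h3
  refine h4.trans ?_
  change mfderiv 𝓘(ℝ, Coord n) 𝓘(ℝ, Coord n) φ u.1 (mfderiv 𝓘(ℝ, Coord n).tangent 𝓘(ℝ, Coord n)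
      (fun w : TangentBundle 𝓘(ℝ, Coord n) M => w.1) u (S u)) = _
  rw [hS.semispray u hu']
  rfl

theorem fieldCoord_eq (hS : IsSpray S) {u : TangentBundle 𝓘(ℝ, Coord n) M}
    (hu : u.1 ∈ φ.source) (hu' : u ∈ slit n M) :
    fieldCoord S φ u = ((toCoord φ u).2, -sprayCoeff S φ (toCoord φ u)) := by
  rw [sprayCoeff_toCoord hφ hu, neg_neg, ← fieldCoord_fst hφ hS hu hu']

end Charts

/-! ### Changes of chart, geodesics and ribbons on the manifold -/

section ManifoldRibbons

variable {n : ℕ} {M : Type*} [TopologicalSpace M] [ChartedSpace (Coord n) M]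
  [IsManifold 𝓘(ℝ, Coord n) ∞ M] {S : FieldOnTangent n M}
  {φ ψ : OpenPartialHomeomorph M (Coord n)}

theorem IsSprayCoeff.mono {F : Coord n × Coord n → Coord n} {U V : Set (Coord n)}
    (h : IsSprayCoeff F U) (hV : IsOpen V) (hVU : V ⊆ U) : IsSprayCoeff F V where
  isOpen := hV
  smooth p hp := h.smooth p ⟨hVU hp.1, hp.2⟩
  homogeneous p hp := h.homogeneous p ⟨hVU hp.1, hp.2⟩

/-- The domain of the change of coordinates from `φ` to `ψ`. -/
def overlap (φ ψ : OpenPartialHomeomorph M (Coord n)) : Set (Coord n) :=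
  φ.target ∩ φ.symm ⁻¹' ψ.source

omit [ChartedSpace (Coord n) M] [IsManifold 𝓘(ℝ, Coord n) ∞ M] in
theorem isOpen_overlap : IsOpen (overlap φ ψ) :=
  φ.isOpen_inter_preimage_symm ψ.open_source

variable (hφ : φ ∈ IsManifold.maximalAtlas 𝓘(ℝ, Coord n) ∞ M)
  (hψ : ψ ∈ IsManifold.maximalAtlas 𝓘(ℝ, Coord n) ∞ M)
include hφ hψ

omit [IsManifold 𝓘(ℝ, Coord n) ∞ M] in
theorem contDiffAt_transition {x : Coord n} (hx : x ∈ overlap φ ψ) :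
    ContDiffAt ℝ ∞ (ψ ∘ φ.symm) x :=
  ((contMDiffAt_of_mem_maximalAtlas hψ hx.2).comp x
    (contMDiffAt_symm_of_mem_maximalAtlas hφ hx.1)).contDiffAt

omit [IsManifold 𝓘(ℝ, Coord n) ∞ M] in
theorem toCoord_transition {u : TangentBundle 𝓘(ℝ, Coord n) M} (hu : u.1 ∈ φ.source)
    (hu' : u.1 ∈ ψ.source) : toCoord ψ u
      = (ψ (φ.symm (toCoord φ u).1), fderiv ℝ (ψ ∘ φ.symm) (toCoord φ u).1 (toCoord φ u).2) := by
  have hx : φ u.1 ∈ φ.target := φ.map_source hu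
  have e : φ.symm (φ u.1) = u.1 := φ.left_inv hu
  have h1 : MDifferentiableAt 𝓘(ℝ, Coord n) 𝓘(ℝ, Coord n) ψ (φ.symm (φ u.1)) := by
    rw [e]; exact (mdifferentiable_chart hψ).mdifferentiableAt hu'
  have h2 := ((mdifferentiable_chart hφ).mdifferentiableAt hu)
  have h3 : MDifferentiableAt 𝓘(ℝ, Coord n) 𝓘(ℝ, Coord n) (ψ ∘ φ.symm) (φ u.1) :=
    h1.comp (φ u.1) ((mdifferentiable_chart hφ).mdifferentiableAt_symm hx)
  have h4 : ψ =ᶠ[𝓝 u.1] (ψ ∘ φ.symm) ∘ φ := by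
    filter_upwards [φ.open_source.mem_nhds hu] with y hy
    simp [φ.left_inv hy]
  refine Prod.ext (congrArg ψ e).symm ?_
  change mfderiv 𝓘(ℝ, Coord n) 𝓘(ℝ, Coord n) ψ u.1 u.2 = fderiv ℝ (ψ ∘ φ.symm) (φ u.1)
    (mfderiv 𝓘(ℝ, Coord n) 𝓘(ℝ, Coord n) φ u.1 u.2)
  have h5 := (h3.hasMFDerivAt.comp u.1 h2.hasMFDerivAt).congr_of_eventuallyEq h4
  rw [h5.mfderiv, mfderiv_eq_fderiv]
  rfl

theorem fieldCoord_transition {u : TangentBundle 𝓘(ℝ, Coord n) M} (hu : u.1 ∈ φ.source)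
    (hu' : u.1 ∈ ψ.source) : fieldCoord S ψ u
      = fderiv ℝ (fun p : Coord n × Coord n => (ψ (φ.symm p.1), fderiv ℝ (ψ ∘ φ.symm) p.1 p.2))
          (toCoord φ u) (fieldCoord S φ u) := by
  have hx : (toCoord φ u).1 ∈ overlap φ ψ := ⟨φ.map_source hu, by
    change φ.symm (φ u.1) ∈ ψ.source
    rwa [φ.left_inv hu]⟩
  have hχ := contDiffAt_transition hφ hψ hx
  have hd : DifferentiableAt ℝ (fun p : Coord n × Coord n =>
      (ψ (φ.symm p.1), fderiv ℝ (ψ ∘ φ.symm) p.1 p.2)) (toCoord φ u) := by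
    have h1 : ContDiffAt ℝ ∞ (fun p : Coord n × Coord n => ψ (φ.symm p.1)) (toCoord φ u) :=
      hχ.comp (toCoord φ u) contDiffAt_fst
    have h2 : ContDiffAt ℝ ∞ (fun p : Coord n × Coord n => fderiv ℝ (ψ ∘ φ.symm) p.1 p.2)
        (toCoord φ u) :=
      ((contDiffAt_fderiv hχ).comp (toCoord φ u) contDiffAt_fst).clm_apply contDiffAt_snd
    exact (h1.prodMk h2).differentiableAt (by simp)
  have ho : ∀ᶠ w in 𝓝 u, w.1 ∈ φ.source ∩ ψ.source :=
    ((φ.open_source.inter ψ.open_source).preimage (FiberBundle.continuous_proj (Coord n)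
      (TangentSpace 𝓘(ℝ, Coord n)))).mem_nhds ⟨hu, hu'⟩
  have e : toCoord ψ =ᶠ[𝓝 u] (fun p : Coord n × Coord n =>
      (ψ (φ.symm p.1), fderiv ℝ (ψ ∘ φ.symm) p.1 p.2)) ∘ toCoord φ := by
    filter_upwards [ho] with w hw using toCoord_transition hφ hψ hw.1 hw.2
  have h5 := (hd.hasFDerivAt.hasMFDerivAt.comp u
    (mdifferentiableAt_toCoord hφ hu).hasMFDerivAt).congr_of_eventuallyEq e
  rw [fieldCoord, h5.mfderiv]
  rfl

/-- The components of S are pushed forward by the derivative of (x, y) ↦ (χ(x), Dχ(x)y); in the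
second slot, differentiating Dχ(x) along y gives the D²χ(y, y) term. -/
theorem isSprayTransition (hS : IsSpray S) : IsSprayTransition (sprayCoeff S φ) (overlap φ ψ)
    (sprayCoeff S ψ) ψ.target (ψ ∘ φ.symm) := by
  have hm (p : Coord n × Coord n) (hp : p ∈ slitOver (overlap φ ψ)) :
      (ofCoord φ p).1 ∈ φ.source ∧ (ofCoord φ p).1 ∈ ψ.source ∧ ofCoord φ p ∈ slit n M ∧
        toCoord φ (ofCoord φ p) = p :=
    ⟨φ.map_target hp.1.1, hp.1.2, ofCoord_mem_slit hφ ⟨hp.1.1, hp.2⟩,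
      toCoord_ofCoord hφ hp.1.1⟩
  have ht (p : Coord n × Coord n) (hp : p ∈ slitOver (overlap φ ψ)) :
      ((ψ ∘ φ.symm) p.1, fderiv ℝ (ψ ∘ φ.symm) p.1 p.2) = toCoord ψ (ofCoord φ p) := by
    obtain ⟨h1, h2, -, h4⟩ := hm p hp
    rw [toCoord_transition hφ hψ h1 h2, h4]
    rfl
  refine ⟨(isSprayCoeff hφ hS).mono isOpen_overlap inter_subset_left, isSprayCoeff hψ hS,
    fun x hx => contDiffAt_transition hφ hψ hx, fun p hp => ?_, fun p hp => ?_⟩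
  · rw [ht p hp]
    exact toCoord_mem hψ (hm p hp).2.1 (hm p hp).2.2.1
  · obtain ⟨h1, h2, h3, h4⟩ := hm p hp
    have hχ := contDiffAt_transition hφ hψ hp.1
    have hc : DifferentiableAt ℝ (fun p : Coord n × Coord n => ψ (φ.symm p.1)) p :=
      (hχ.comp p contDiffAt_fst).differentiableAt (by simp)
    have hc' : DifferentiableAt ℝ (fun p : Coord n × Coord n => fderiv ℝ (ψ ∘ φ.symm) p.1) p :=
      ((contDiffAt_fderiv hχ).comp p contDiffAt_fst).differentiableAt (by simp)
    have hf := congrArg Prod.snd (fieldCoord_transition (S := S) hφ hψ h1 h2)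
    rw [fieldCoord_eq hψ hS h2 h3, fieldCoord_eq hφ hS h1 h3, h4, ← ht p hp,
      hc.fderiv_prodMk (hc'.clm_apply differentiableAt_snd)] at hf
    simp only [ContinuousLinearMap.prod_apply] at hf
    rw [fderiv_clm_apply_one hc' differentiableAt_snd,
      fderiv_comp_apply (c := Prod.fst) ((contDiffAt_fderiv hχ).differentiableAt (by simp))
        differentiableAt_fst, fderiv_fst, fderiv_snd] at hf
    simp only [ContinuousLinearMap.coe_fst', ContinuousLinearMap.coe_snd', map_neg] at hf
    rw [eq_comm, neg_eq_iff_eq_neg.1 hf.symm.symm]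
    abel

omit hψ [IsManifold 𝓘(ℝ, Coord n) ∞ M] in
theorem toCoord_velocity {γ : ℝ → M} {t : ℝ} (hγ : MDifferentiableAt 𝓘(ℝ, ℝ) 𝓘(ℝ, Coord n) γ t)
    (ht : γ t ∈ φ.source) :
    toCoord φ (velocity γ t) = (φ (γ t), deriv (fun s => φ (γ s)) t) := by
  refine Prod.ext rfl ?_
  let D : ℝ →L[ℝ] Coord n := (mfderiv 𝓘(ℝ, Coord n) 𝓘(ℝ, Coord n) φ (γ t)).comp
    (mfderiv 𝓘(ℝ, ℝ) 𝓘(ℝ, Coord n) γ t)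
  have h : HasFDerivAt (fun s => φ (γ s)) D t :=
    (((mdifferentiable_chart hφ).mdifferentiableAt ht).hasMFDerivAt.comp t
      hγ.hasMFDerivAt).hasFDerivAt
  exact h.hasDerivAt.deriv.symm

omit hψ in
/-- The geodesic equation in a chart. -/
theorem IsSprayGeodesic.deriv_deriv_eq (hS : IsSpray S) {γ : ℝ → M} {I : Set ℝ} (hI : IsOpen I)
    (h : IsSprayGeodesic S γ I) (hγ : ∀ t ∈ I, MDifferentiableAt 𝓘(ℝ, ℝ) 𝓘(ℝ, Coord n) γ t)
    {t : ℝ} (ht : t ∈ I) (htφ : γ t ∈ φ.source) :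
    deriv (fun s => φ (γ s)) t ≠ 0 ∧ deriv (deriv fun s => φ (γ s)) t
      = -sprayCoeff S φ (φ (γ t), deriv (fun s => φ (γ s)) t) := by
  have hv := toCoord_velocity hφ (hγ t ht) htφ
  have hu : (velocity γ t : TangentBundle 𝓘(ℝ, Coord n) M).1 ∈ φ.source := htφ
  constructor
  · have h0 := toCoord_snd_ne_zero hφ hu (h.1 t ht)
    rwa [hv] at h0
  · have h1 : HasFDerivAt (toCoord φ ∘ velocity γ)
        ((1 : ℝ →L[ℝ] ℝ).smulRight (fieldCoord S φ (velocity γ t))) t := by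
      have h2 := (mdifferentiableAt_toCoord hφ hu).hasMFDerivAt.comp t
        ((h.2 t ht).hasMFDerivAt (hI.mem_nhds ht))
      refine (h2.congr_mfderiv ?_).hasFDerivAt
      symm
      refine ContinuousLinearMap.ext fun r => ?_
      exact ((mfderiv 𝓘(ℝ, Coord n).tangent 𝓘(ℝ, Coord n × Coord n) (toCoord φ)
        (velocity γ t)).map_smul r (S (velocity γ t))).symm
    have e : toCoord φ ∘ velocity γ =ᶠ[𝓝 t] fun s => (φ (γ s), deriv (fun s => φ (γ s)) s) := by
      filter_upwards [hI.mem_nhds ht, (hγ t ht).continuousAt.preimage_mem_nhds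
        (φ.open_source.mem_nhds htφ)] with r hr hrφ using toCoord_velocity hφ (hγ r hr) hrφ
    have h2 := (hasFDerivAt_snd.comp_hasDerivAt t
      (h1.congr_of_eventuallyEq e.symm).hasDerivAt).deriv
    refine h2.trans ?_
    have h3 := congrArg Prod.snd (fieldCoord_eq hφ hS hu (h.1 t ht))
    rw [hv] at h3
    refine Eq.trans ?_ h3
    simp

omit hφ hψ [IsManifold 𝓘(ℝ, Coord n) ∞ M] in
theorem mdifferentiableAt_slice {I : Set ℝ} (hI : IsOpen I) {ε₀ : ℝ} {Λ : ℝ × ℝ → M}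
    (hΛ : ContMDiffOn 𝓘(ℝ, ℝ × ℝ) 𝓘(ℝ, Coord n) ∞ Λ (Ioo (-ε₀) ε₀ ×ˢ I)) {ε t : ℝ}
    (hε : ε ∈ Ioo (-ε₀) ε₀) (ht : t ∈ I) :
    MDifferentiableAt 𝓘(ℝ, ℝ) 𝓘(ℝ, Coord n) (fun s => Λ (ε, s)) t := by
  have h1 : MDifferentiableAt 𝓘(ℝ, ℝ × ℝ) 𝓘(ℝ, Coord n) Λ (ε, t) :=
    (hΛ.contMDiffAt ((isOpen_Ioo.prod hI).mem_nhds ⟨hε, ht⟩)).mdifferentiableAt (by simp)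
  have h2 : DifferentiableAt ℝ (fun s : ℝ => (ε, s)) t := by fun_prop
  exact h1.comp t h2.mdifferentiableAt

omit hψ in
theorem deriv_deriv_ribbonCoord (hS : IsSpray S) {I : Set ℝ}
    (hI : IsOpen I) {ε₀ : ℝ} {Λ : ℝ × ℝ → M}
    (hΛ : ContMDiffOn 𝓘(ℝ, ℝ × ℝ) 𝓘(ℝ, Coord n) ∞ Λ (Ioo (-ε₀) ε₀ ×ˢ I)) {ε t : ℝ}
    (hε : ε ∈ Ioo (-ε₀) ε₀) (ht : t ∈ I) (h : IsSprayGeodesic S (fun s => Λ (ε, s)) I)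
    (htφ : Λ (ε, t) ∈ φ.source) :
    deriv (ribbonCoord φ Λ ε) t ≠ 0 ∧ deriv (deriv (ribbonCoord φ Λ ε)) t
      = -sprayCoeff S φ (ribbonCoord φ Λ ε t, deriv (ribbonCoord φ Λ ε) t) :=
  h.deriv_deriv_eq hφ hS hI (fun _ hr => mdifferentiableAt_slice hI hΛ hε hr) ht htφ

omit hψ [IsManifold 𝓘(ℝ, Coord n) ∞ M] in
theorem contDiffAt_surface {I : Set ℝ} (hI : IsOpen I) {ε₀ : ℝ} {Λ : ℝ × ℝ → M}
    (hΛ : ContMDiffOn 𝓘(ℝ, ℝ × ℝ) 𝓘(ℝ, Coord n) ∞ Λ (Ioo (-ε₀) ε₀ ×ˢ I)) {z : ℝ × ℝ}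
    (hz : z ∈ Ioo (-ε₀) ε₀ ×ˢ I) (hzφ : Λ z ∈ φ.source) :
    ContDiffAt ℝ ∞ (surface (ribbonCoord φ Λ)) z :=
  ((contMDiffAt_of_mem_maximalAtlas hφ hzφ).comp z
    (hΛ.contMDiffAt ((isOpen_Ioo.prod hI).mem_nhds hz))).contDiffAt

omit hψ in
/-- A ribbon with a geodesic as central curve, in a chart. -/
theorem isRibbonOn (hS : IsSpray S) {I : Set ℝ} (hI : IsOpen I) {ε₀ : ℝ} (hε₀ : 0 < ε₀)
    {Λ : ℝ × ℝ → M} (hΛ : ContMDiffOn 𝓘(ℝ, ℝ × ℝ) 𝓘(ℝ, Coord n) ∞ Λ (Ioo (-ε₀) ε₀ ×ˢ I))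
    (hX : IsSprayGeodesic S (fun s => Λ (0, s)) I) {U : Set (Coord n)} (hU : IsOpen U)
    (hUφ : U ⊆ φ.target) {W : Set (ℝ × ℝ)} (hW : IsOpen W) (hWI : W ⊆ Ioo (-ε₀) ε₀ ×ˢ I)
    (hWφ : ∀ z ∈ W, Λ z ∈ φ.source ∧ φ (Λ z) ∈ U)
    (hW' : ∀ z ∈ W, fderiv ℝ (surface (ribbonCoord φ Λ)) z (0, 1) ≠ 0) :
    IsRibbonOn (sprayCoeff S φ) U (ribbonCoord φ Λ) W where
  coeff := (isSprayCoeff hφ hS).mono hU hUφ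
  isOpen := hW
  smooth z hz := contDiffAt_surface hφ hI hΛ (hWI hz) (hWφ z hz).1
  mem z hz := ⟨(hWφ z hz).2, hW' z hz⟩
  deriv_deriv_central s hs :=
    (deriv_deriv_ribbonCoord hφ hS hI hΛ (by simpa using hε₀) (hWI hs).2 hX (hWφ _ hs).1).2

/-- Only the central curve is known to have nonzero velocity; by continuity this, and membership in
both charts, persists near (0, s), which suffices for derivatives at ε = 0. -/
theorem exists_ribbon_domain (hS : IsSpray S) {I : Set ℝ} (hI : IsOpen I) {ε₀ : ℝ} (hε₀ : 0 < ε₀)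
    {Λ : ℝ × ℝ → M} (hΛ : ContMDiffOn 𝓘(ℝ, ℝ × ℝ) 𝓘(ℝ, Coord n) ∞ Λ (Ioo (-ε₀) ε₀ ×ˢ I))
    (hX : IsSprayGeodesic S (fun s => Λ (0, s)) I) {s : ℝ} (hs : s ∈ I)
    (hsφ : Λ (0, s) ∈ φ.source) (hsψ : Λ (0, s) ∈ ψ.source) :
    ∃ W : Set (ℝ × ℝ), IsOpen W ∧ (0, s) ∈ W ∧ W ⊆ Ioo (-ε₀) ε₀ ×ˢ I ∧
      ∀ z ∈ W, Λ z ∈ φ.source ∧ Λ z ∈ ψ.source ∧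
        fderiv ℝ (surface (ribbonCoord φ Λ)) z (0, 1) ≠ 0 ∧
        fderiv ℝ (surface (ribbonCoord ψ Λ)) z (0, 1) ≠ 0 := by
  have h0 : (0 : ℝ) ∈ Ioo (-ε₀) ε₀ := by simpa using hε₀
  have hD : Ioo (-ε₀) ε₀ ×ˢ I ∈ 𝓝 ((0 : ℝ), s) := (isOpen_Ioo.prod hI).mem_nhds ⟨h0, hs⟩
  have hc : ContinuousAt Λ (0, s) := (hΛ.contMDiffAt hD).continuousAt
  have hne {χ : OpenPartialHomeomorph M (Coord n)}
      (hχ : χ ∈ IsManifold.maximalAtlas 𝓘(ℝ, Coord n) ∞ M) (hsχ : Λ (0, s) ∈ χ.source) :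
      ∀ᶠ z in 𝓝 (0, s), fderiv ℝ (surface (ribbonCoord χ Λ)) z (0, 1) ≠ 0 := by
    have hx := contDiffAt_surface hχ hI hΛ (z := (0, s)) ⟨h0, hs⟩ hsχ
    refine (contDiffAt_fderiv_apply hx (0, 1)).continuousAt.eventually_ne ?_
    rw [← deriv_slice_right (hx.differentiableAt (by simp))]
    exact (deriv_deriv_ribbonCoord hχ hS hI hΛ h0 hs hX hsχ).1
  obtain ⟨W, hW, hWo, hWs⟩ := mem_nhds_iff.1 (Filter.inter_mem hD (Filter.inter_mem
    (hc.preimage_mem_nhds (φ.open_source.mem_nhds hsφ)) (Filter.inter_mem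
      (hc.preimage_mem_nhds (ψ.open_source.mem_nhds hsψ)) ((hne hφ hsφ).and (hne hψ hsψ)))))
  exact ⟨W, hWo, hWs, fun z hz => (hW hz).1, fun z hz =>
    ⟨(hW hz).2.1, (hW hz).2.2.1, (hW hz).2.2.2⟩⟩

end ManifoldRibbons

end FinslerDeviation

end

/-! ### The theorem on the manifold -/

theorem mainTheorem4 {n : ℕ} {M : Type*} [TopologicalSpace M] [T2Space M]
    [SecondCountableTopology M] [ChartedSpace (Coord n) M] [IsManifold 𝓘(ℝ, Coord n) ∞ M]
    (L : TangentBundle 𝓘(ℝ, Coord n) M → ℝ) (hL : IsPseudoFinsler L)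
    (S : FieldOnTangent n M) (hS : IsFinslerSpray L S)
    (I : Set ℝ) (hI : IsOpen I) (hI' : I.OrdConnected)
    (ε₀ : ℝ) (hε₀ : 0 < ε₀) (Λ : ℝ × ℝ → M)
    (hΛ : ContMDiffOn 𝓘(ℝ, ℝ × ℝ) 𝓘(ℝ, Coord n) ∞ Λ (Ioo (-ε₀) ε₀ ×ˢ I))
    (hX : IsSprayGeodesic S (fun s => Λ (0, s)) I)
    (φ : OpenPartialHomeomorph M (Coord n))
    (hφ : φ ∈ IsManifold.maximalAtlas 𝓘(ℝ, Coord n) ∞ M)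
    (s : ℝ) (hs : s ∈ I) (hsφ : Λ (0, s) ∈ φ.source) :
    -- the first order deviation equation is the Jacobi equation
    (devCoeff (sprayCoeff S φ) (ribbonCoord φ Λ) 1 s
      = jacobiOp (sprayCoeff S φ) (ribbonCoord φ Λ) (xiCoeff (ribbonCoord φ Λ) 1) s) ∧
    -- given the first order equation, the second order one is the covariant equation for `J₂`
    (devCoeff (sprayCoeff S φ) (ribbonCoord φ Λ) 1 s = 0 →
      (2 : ℝ) • devCoeff (sprayCoeff S φ) (ribbonCoord φ Λ) 2 s
        = jacobiOp (sprayCoeff S φ) (ribbonCoord φ Λ)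
            (jTwo (sprayCoeff S φ) (ribbonCoord φ Λ)) s
          - secondOrderRHS (sprayCoeff S φ) (ribbonCoord φ Λ) s) ∧
    -- both equations hold along a variation through geodesics
    ((∀ ε ∈ Ioo (-ε₀) ε₀, IsSprayGeodesic S (fun s => Λ (ε, s)) I) →
      jacobiOp (sprayCoeff S φ) (ribbonCoord φ Λ) (xiCoeff (ribbonCoord φ Λ) 1) s = 0 ∧
      jacobiOp (sprayCoeff S φ) (ribbonCoord φ Λ) (jTwo (sprayCoeff S φ) (ribbonCoord φ Λ)) s
        = secondOrderRHS (sprayCoeff S φ) (ribbonCoord φ Λ) s) ∧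
    -- covariance: `Ξ₁`, `J₂` and the two equations transform as vectors under changes of chart
    (∀ ψ ∈ IsManifold.maximalAtlas 𝓘(ℝ, Coord n) ∞ M, Λ (0, s) ∈ ψ.source →
      xiCoeff (ribbonCoord ψ Λ) 1 s
        = fderiv ℝ (ψ ∘ φ.symm) (φ (Λ (0, s))) (xiCoeff (ribbonCoord φ Λ) 1 s) ∧
      jTwo (sprayCoeff S ψ) (ribbonCoord ψ Λ) s
        = fderiv ℝ (ψ ∘ φ.symm) (φ (Λ (0, s)))
            (jTwo (sprayCoeff S φ) (ribbonCoord φ Λ) s) ∧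
      jacobiOp (sprayCoeff S ψ) (ribbonCoord ψ Λ) (xiCoeff (ribbonCoord ψ Λ) 1) s
        = fderiv ℝ (ψ ∘ φ.symm) (φ (Λ (0, s)))
            (jacobiOp (sprayCoeff S φ) (ribbonCoord φ Λ) (xiCoeff (ribbonCoord φ Λ) 1) s) ∧
      (devCoeff (sprayCoeff S φ) (ribbonCoord φ Λ) 1 s = 0 →
        jacobiOp (sprayCoeff S ψ) (ribbonCoord ψ Λ) (jTwo (sprayCoeff S ψ) (ribbonCoord ψ Λ)) s
            - secondOrderRHS (sprayCoeff S ψ) (ribbonCoord ψ Λ) s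
          = fderiv ℝ (ψ ∘ φ.symm) (φ (Λ (0, s)))
              (jacobiOp (sprayCoeff S φ) (ribbonCoord φ Λ)
                  (jTwo (sprayCoeff S φ) (ribbonCoord φ Λ)) s
                - secondOrderRHS (sprayCoeff S φ) (ribbonCoord φ Λ) s))) := by
  have hS' := hS.isSpray
  -- The first three claims involve one chart, so it plays both roles here.
  obtain ⟨W, hW, hsW, hWI, hWφ⟩ := exists_ribbon_domain hφ hφ hS' hI hε₀ hΛ hX hs hsφ hsφ
  have hR := isRibbonOn hφ hS' hI hε₀ hΛ hX φ.open_target subset_rfl hW hWI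
    (fun z hz => ⟨(hWφ z hz).1, φ.map_source (hWφ z hz).1⟩) (fun z hz => (hWφ z hz).2.2.1)
  have h1 := hR.devCoeff_one_eq_jacobiOp hsW
  have h2 := hR.devCoeff_two_eq hsW
  refine ⟨h1, h2, fun hg => ?_, fun ψ hψ hsψ => ?_⟩
  · obtain ⟨g1, g2⟩ := hR.devCoeff_eq_zero hsW fun ε t ht =>
      (deriv_deriv_ribbonCoord hφ hS' hI hΛ (hWI ht).1 (hWI ht).2 (hg ε (hWI ht).1)
        (hWφ _ ht).1).2
    refine ⟨h1.symm.trans g1, ?_⟩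
    have h3 := h2 g1
    rw [g2, smul_zero] at h3
    exact sub_eq_zero.1 h3.symm
  · obtain ⟨W', hW', hsW', hWI', hWφ'⟩ :=
      exists_ribbon_domain hφ hψ hS' hI hε₀ hΛ hX hs hsφ hsψ
    have hT := isSprayTransition hφ hψ hS'
    -- The ribbon is restricted to the overlap, where the transition map is smooth.
    have hRφ := isRibbonOn hφ hS' hI hε₀ hΛ hX isOpen_overlap inter_subset_left hW' hWI'
      (fun z hz => ⟨(hWφ' z hz).1, φ.map_source (hWφ' z hz).1, by
        rw [mem_preimage, φ.left_inv (hWφ' z hz).1]; exact (hWφ' z hz).2.1⟩)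
      (fun z hz => (hWφ' z hz).2.2.1)
    have hRψ := isRibbonOn hψ hS' hI hε₀ hΛ hX ψ.open_target subset_rfl hW' hWI'
      (fun z hz => ⟨(hWφ' z hz).2.1, ψ.map_source (hWφ' z hz).2.1⟩)
      (fun z hz => (hWφ' z hz).2.2.2)
    have hc (z : ℝ × ℝ) (hz : z ∈ W') : surface (ribbonCoord ψ Λ) z
        = (ψ ∘ φ.symm) (surface (ribbonCoord φ Λ) z) :=
      congrArg ψ (φ.left_inv (hWφ' z hz).1).symm
    have hd1 := hT.devCoeff_one_law hRφ hRψ hc hsW'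
    refine ⟨hT.xiCoeff_one_law hRφ hRψ hc hsW', hT.jTwo_law hRφ hRψ hc hsW', ?_, fun g1 => ?_⟩
    · rw [← h1, ← hRψ.devCoeff_one_eq_jacobiOp hsW']
      exact hd1
    -- The first order equation passes to the chart ψ, so in both charts the difference of the two
    -- sides is 2 G₂, and no transformation law of R or P is needed.
    · rw [g1, map_zero] at hd1
      rw [← h2 g1, ← hRψ.devCoeff_two_eq hsW' hd1]
      exact hT.devCoeff_two_law hRφ hRψ hc hsW' g1
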